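/- All graphs are finite and simple; the order of a graph is its number of vertices and its size is its number of edges. A graph is $3$-connected if it has more than three vertices and remains connected after the deletion of any set of at most two vertices. A graph is locally nonforesty if for every vertex $v$ the subgraph induced by the (open) neighborhood of $v$ contains a cycle. For an integer $n\ge 8$ define $$f(n)=\begin{cases}2n-\lfloor n/8\rfloor & \text{if } n\equiv 0,4,7 \pmod 8,\\ 2n+1-\lfloor n/8\rfloor & \text{otherwise.}\end{cases}$$ Then, for every integer $n\ge 8$, the minimum size of a $3$-connected locally nonforesty graph of order $n$ is $f(n)$ (in particular, such a graph of size $f(n)$ exists). Moreover $f(n)\le 2n<7(n-1)/3$ for every $n\ge 8$; hence for every $n\ge 8$ there is a $3$-connected locally nonforesty graph of order $n$ and size less than $7(n-1)/3$, which disproves the conjecture of Chernyshev, Rauch and Rautenbach that every $3$-connected locally nonforesty graph of order $n$ and size $m$ satisfies $m\ge 7(n-1)/3$. -/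

import Mathlib

/-- The local subgraph of `G` at `v`: the subgraph induced by the (open) neighborhood of `v`. -/
abbrev localSubgraph {V : Type*} (G : SimpleGraph V) (v : V) :
    SimpleGraph (G.neighborSet v) :=
  G.induce (G.neighborSet v)

/-- `G` is locally nonforesty: every local subgraph contains a cycle. -/
def LocallyNonforesty {V : Type*} (G : SimpleGraph V) : Prop :=
  ∀ v : V, ∃ (u : G.neighborSet v) (c : (localSubgraph G v).Walk u u), c.IsCycle

/-- A finite graph is `k`-connected: it has more than `k` vertices, and deleting any set of fewer
than `k` vertices leaves a connected graph. -/
def IsKConnected {V : Type*} [Fintype V] (k : ℕ) (G : SimpleGraph V) : Prop :=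
  k < Fintype.card V ∧
    ∀ S : Finset V, S.card < k → (G.induce ((S : Set V)ᶜ)).Connected

/-- The function `f(n)`; the subtraction never truncates, since `n / 8 ≤ 2 * n`. -/
def minSizeFormula (n : ℕ) : ℕ :=
  if n % 8 = 0 ∨ n % 8 = 4 ∨ n % 8 = 7 then 2 * n - n / 8 else 2 * n + 1 - n / 8

/-!
Lower bound. A vertex of degree three in a locally nonforesty graph lies in a `K₄`, and
3-connectivity keeps these copies of `K₄` apart: vertices of
degree three, called cubic here, are not adjacent, and a vertex of
degree four has at most one cubic neighbour. Let every vertex send `1` to each cubic neighbour and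
give `v` the initial charge `4 deg v - 15`. The final charges are nonnegative, and they sum to
`8 m - 15 n` (`sum_charge`), which gives `m ≥ 15 n / 8` and settles the residues `0`, `4`, `7` of
`n` modulo `8`. For the other residues one more edge is needed because the total charge `s`, which
is congruent to `n` modulo `8`, cannot be `1`, `2`, `3`, `5` or `6`
(`sum_charge_eq_zero_or_four`): if `s ≤ 6`, there is at most one vertex of degree at least five,
and the free vertices, which are neither cubic nor adjacent to a cubic vertex, find their cycles
among each other (`subset_freeVertices_of_core`). If there are free vertices, then all degrees are
at most four, `s` is the number of free vertices, that number is at least four, and five or six of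
them would be separated from the rest by two vertices or would exceed degree four
(`card_freeVertices_le_four`). If there are none, `s` is `0`, or `4` for a single vertex of degree
five.

Upper bound. Deleting two edges `xy` and `zw` of a 3-connected graph and rerouting them through two
new copies of `K₄`, joined by one edge, keeps the graph 3-connected and adds 8 vertices and 15 edges
(`isKConnected_attachTwin`). If every vertex lies in a `K₄` that avoids the two edges, this persists
(`Growable.add_eight`), so it suffices to find one graph for each order from 8 to 15; their
connectivity is checked by a verified graph search.
-/

/-! ### Connectivity after deleting vertices -/

/-- The vertices outside `S` cannot be split by the edges of `G - S`: a property that passes along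
every edge of `G - S` and holds at one vertex outside `S` holds at all of them. -/
def LinkedOutside {V : Type*} (G : SimpleGraph V) (S : Finset V) : Prop :=
  ∀ p : V → Prop, (∀ a b, a ∉ S → b ∉ S → G.Adj a b → p a → p b) →
    ∀ u v, u ∉ S → v ∉ S → p u → p v

lemma linkedOutside_iff_preconnected {V : Type*} (G : SimpleGraph V) (S : Finset V) :
    LinkedOutside G S ↔ (G.induce ((S : Set V)ᶜ)).Preconnected := by
  constructor
  · rintro h ⟨u, hu⟩ ⟨v, hv⟩
    have := h (fun a => ∃ ha : a ∈ ((S : Set V)ᶜ),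
      (G.induce ((S : Set V)ᶜ)).Reachable ⟨u, hu⟩ ⟨a, ha⟩) ?_ u v
      (by simpa using hu) (by simpa using hv) ⟨hu, .refl _⟩
    · exact this.2
    · rintro a b ha hb hab ⟨_, h2⟩
      refine ⟨by simpa using hb, h2.trans (SimpleGraph.Adj.reachable ?_)⟩
      simpa using hab
  · intro h p hp u v hu hv hpu
    obtain ⟨w⟩ := h ⟨u, by simpa using hu⟩ ⟨v, by simpa using hv⟩
    have key : ∀ (a b : ↑((S : Set V)ᶜ)) (_ : (G.induce ((S : Set V)ᶜ)).Walk a b),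
        p a → p b := by
      intro a b w
      induction w with
      | nil => exact id
      | @cons a c b hac _ ih =>
        exact fun ha => ih (hp a c (fun h => a.2 h) (fun h => c.2 h) (by simpa using hac) ha)
    exact key _ _ w hpu

lemma isKConnected_iff {V : Type*} [Fintype V] (k : ℕ) (G : SimpleGraph V) :
    IsKConnected k G ↔
      k < Fintype.card V ∧ ∀ S : Finset V, S.card < k → LinkedOutside G S := by
  refine and_congr_right fun hk => forall₂_congr fun S hS => ?_
  rw [SimpleGraph.connected_iff, linkedOutside_iff_preconnected, and_iff_left]
  obtain ⟨v, hv⟩ := Finset.exists_mem_notMem_of_card_lt_card (s := S) (t := Finset.univ)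
    (by rw [Finset.card_univ]; omega)
  exact ⟨⟨v, by simpa using hv.2⟩⟩

/-- A single edge is worth at most one vertex: deleting an edge lowers connectivity by at most
one. -/
lemma IsKConnected.of_sup_edge {V : Type*} [Fintype V] {k : ℕ} {H : SimpleGraph V} {x y : V}
    (h : IsKConnected (k + 1) (H ⊔ SimpleGraph.edge x y)) : IsKConnected k H := by
  classical
  rw [isKConnected_iff] at h ⊢
  obtain ⟨hc, h⟩ := h
  refine ⟨by omega, fun S hS p hp u v hu hv hpu => ?_⟩
  -- Outside `S ∪ {x}` and outside `S ∪ {y}` the deleted edge plays no role.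
  have hx : ∀ a b, a ∉ S → b ∉ S → a ≠ x → b ≠ x → p a → p b := by
    intro a b ha hb hax hbx
    refine h (insert x S) (by have := Finset.card_insert_le x S; omega) p ?_ a b
      (by simp [*]) (by simp [*])
    intro c d hc hd hcd
    refine hp c d (by simp_all) (by simp_all) ?_
    simp only [SimpleGraph.sup_adj, SimpleGraph.edge_adj] at hcd
    simp_all
  have hy : ∀ a b, a ∉ S → b ∉ S → a ≠ y → b ≠ y → p a → p b := by
    intro a b ha hb hax hbx
    refine h (insert y S) (by have := Finset.card_insert_le y S; omega) p ?_ a b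
      (by simp [*]) (by simp [*])
    intro c d hc hd hcd
    refine hp c d (by simp_all) (by simp_all) ?_
    simp only [SimpleGraph.sup_adj, SimpleGraph.edge_adj] at hcd
    simp_all
  obtain ⟨t, -, ht⟩ := Finset.exists_mem_notMem_of_card_lt_card (s := insert x (insert y S))
    (t := Finset.univ) (by
      have := Finset.card_insert_le y S
      have := Finset.card_insert_le x (insert y S)
      rw [Finset.card_univ]; omega)
  simp only [Finset.mem_insert, not_or] at ht
  by_cases hxy : x = y
  · subst hxy
    exact h S (by omega) p (fun a b ha hb hab => hp a b ha hb (by simpa using hab)) u v hu hv hpu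
  · by_cases hux : u = x
    · by_cases hvy : v = y
      · exact hx t v ht.2.2 hv ht.1 (by grind) (hy u t hu ht.2.2 (by grind) ht.2.1 hpu)
      · exact hy u v hu hv (by grind) hvy hpu
    · by_cases hvx : v = x
      · by_cases huy : u = y
        · exact hy t v ht.2.2 hv ht.2.1 (by grind) (hx u t hu ht.2.2 hux ht.1 hpu)
        · exact hy u v hu hv huy (by grind) hpu
      · exact hx u v hu hv hux hvx hpu

lemma IsKConnected.iso {V W : Type*} [Fintype V] [Fintype W] {k : ℕ} {G : SimpleGraph V}
    {H : SimpleGraph W} (e : G ≃g H) (h : IsKConnected k G) : IsKConnected k H := by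
  classical
  rw [isKConnected_iff] at h ⊢
  refine ⟨by rw [← Fintype.card_congr e.toEquiv]; exact h.1, fun S hS p hp u v hu hv hpu => ?_⟩
  have := h.2 (S.image e.symm)
    ((Finset.card_image_of_injective S e.symm.injective).trans_lt hS) (fun a => p (e a)) ?_
    (e.symm u) (e.symm v) (by simpa using hu) (by simpa using hv) (by simpa using hpu)
  · simpa using this
  · intro a b ha hb hab
    refine hp (e a) (e b) (fun h => ha ?_) (fun h => hb ?_) (e.map_adj_iff.2 hab)
    · exact Finset.mem_image.2 ⟨e a, h, by simp⟩
    · exact Finset.mem_image.2 ⟨e b, h, by simp⟩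

/-! ### Neighbourhoods containing cycles -/

/-- Every vertex of `G` lies in a copy of `K₄`. -/
def CoveredByK4 {V : Type*} (G : SimpleGraph V) : Prop :=
  ∀ v, ∃ a b c, G.Adj v a ∧ G.Adj v b ∧ G.Adj v c ∧ G.Adj a b ∧ G.Adj a c ∧ G.Adj b c

lemma CoveredByK4.locallyNonforesty {V : Type*} {G : SimpleGraph V} (h : CoveredByK4 G) :
    LocallyNonforesty G := by
  intro v
  obtain ⟨a, b, c, ha, hb, hc, hab, hac, hbc⟩ := h v
  have h1 : (localSubgraph G v).Adj ⟨a, ha⟩ ⟨b, hb⟩ := hab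
  have h2 : (localSubgraph G v).Adj ⟨b, hb⟩ ⟨c, hc⟩ := hbc
  have h3 : (localSubgraph G v).Adj ⟨c, hc⟩ ⟨a, ha⟩ := hac.symm
  refine ⟨⟨a, ha⟩, .cons h1 (.cons h2 (.cons h3 .nil)), ?_⟩
  rw [SimpleGraph.Walk.isCycle_def]
  have := hab.ne; have := hac.ne; have := hbc.ne
  simp only [SimpleGraph.Walk.isTrail_def]
  simp [Subtype.ext_iff]
  grind

lemma LocallyNonforesty.iso {V W : Type*} {G : SimpleGraph V}
    {H : SimpleGraph W} (e : G ≃g H) (h : LocallyNonforesty G) : LocallyNonforesty H := by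
  intro w
  obtain ⟨u, c, hc⟩ := h (e.symm w)
  let f : localSubgraph G (e.symm w) →g localSubgraph H w :=
    { toFun := fun x => ⟨e x.1, by
        have := e.map_adj_iff.2 x.2
        simpa using this⟩
      map_rel' := fun {a b} hab => e.map_adj_iff.2 hab }
  refine ⟨f u, c.map f, hc.map ?_⟩
  intro a b hab
  exact Subtype.ext (e.injective (congrArg Subtype.val hab))

/-- The vertices of a cycle in the neighbourhood of `v`, as a set: a nonempty set of neighbours of
`v`, each of which has two neighbours inside the set. -/
lemma LocallyNonforesty.exists_core {V : Type*} [Fintype V] {G : SimpleGraph V}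
    (h : LocallyNonforesty G) (v : V) :
    ∃ C : Finset V, C.Nonempty ∧ (∀ x ∈ C, G.Adj v x) ∧
      ∀ x ∈ C, ∃ a ∈ C, ∃ b ∈ C, a ≠ b ∧ G.Adj x a ∧ G.Adj x b := by
  classical
  obtain ⟨u, c, hc⟩ := h v
  refine ⟨(c.support.map Subtype.val).toFinset, ⟨u.1, by simp⟩, ?_, ?_⟩
  · simp only [List.mem_toFinset, List.mem_map]
    rintro x ⟨y, -, rfl⟩
    exact y.2
  · simp only [List.mem_toFinset, List.mem_map]
    rintro x ⟨y, hy, rfl⟩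
    obtain ⟨a, b, hab, heq⟩ := Set.ncard_eq_two.1 (hc.ncard_neighborSet_toSubgraph_eq_two hy)
    have ha : c.toSubgraph.Adj y a := by
      have : a ∈ c.toSubgraph.neighborSet y := by simp [heq]
      exact this
    have hb : c.toSubgraph.Adj y b := by
      have : b ∈ c.toSubgraph.neighborSet y := by simp [heq]
      exact this
    exact ⟨a, ⟨a, by simpa using ha.snd_mem, rfl⟩, b, ⟨b, by simpa using hb.snd_mem, rfl⟩,
      fun h => hab (Subtype.ext h), ha.adj_sub, hb.adj_sub⟩

/-! ### Extending a graph by two copies of `K₄` -/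

/-- The graph on `Fin n` whose edges are the pairs in the list `E`. -/
def listGraph {n : ℕ} (E : List (Fin n × Fin n)) : SimpleGraph (Fin n) where
  Adj i j := i ≠ j ∧ ((i, j) ∈ E ∨ (j, i) ∈ E)
  symm.symm i j h := by grind
  loopless.irrefl i h := h.1 rfl

instance {n : ℕ} (E : List (Fin n × Fin n)) : DecidableRel (listGraph E).Adj :=
  fun i j => inferInstanceAs (Decidable (i ≠ j ∧ ((i, j) ∈ E ∨ (j, i) ∈ E)))

/-- The six pairs of a four-element set. -/
def pairs {n : ℕ} (a b c d : Fin n) : List (Fin n × Fin n) :=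
  [(a, b), (a, c), (a, d), (b, c), (b, d), (c, d)]

/-- Two disjoint copies of `K₄` joined by one edge. The vertices `0`, `1` of the first copy and `4`,
`5` of the second are left for attaching it to another graph. -/
def twinK4 : SimpleGraph (Fin 8) := listGraph (pairs 0 1 2 3 ++ pairs 4 5 6 7 ++ [(2, 6)])

instance : DecidableRel twinK4.Adj := inferInstanceAs (DecidableRel (listGraph _).Adj)

/-- The graph obtained from `H` by attaching `twinK4`, without the two edges that link `x` and `z`
to the two copies of `K₄`. -/
def attachTwin {V : Type*} (H : SimpleGraph V) (y w : V) : SimpleGraph (V ⊕ Fin 8) :=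
  (H ⊕g twinK4) ⊔ SimpleGraph.edge (.inl y) (.inr 1) ⊔ SimpleGraph.edge (.inl w) (.inr 5)

/-- A property that passes along the edges outside `S` takes the same value at both ends of each of
the four edges between old and new vertices. -/
lemma attachTwin_link {V : Type*} {H : SimpleGraph V} {x y z w : V} {S : Finset (V ⊕ Fin 8)}
    {p : V ⊕ Fin 8 → Prop}
    (hp : ∀ a b, a ∉ S → b ∉ S → (attachTwin H y w ⊔ SimpleGraph.edge (.inl x) (.inr 0) ⊔
      SimpleGraph.edge (.inl z) (.inr 4)).Adj a b → p a → p b) :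
    ∀ a i, (a = x ∧ i = 0 ∨ a = y ∧ i = 1 ∨ a = z ∧ i = 4 ∨ a = w ∧ i = 5) →
      Sum.inl a ∉ S → Sum.inr i ∉ S → (p (.inl a) ↔ p (.inr i)) := by
  intro a i hai ha hi
  have : (attachTwin H y w ⊔ SimpleGraph.edge (.inl x) (.inr 0) ⊔
    SimpleGraph.edge (.inl z) (.inr 4)).Adj (.inl a) (.inr i) := by
    rcases hai with ⟨rfl, rfl⟩ | ⟨rfl, rfl⟩ | ⟨rfl, rfl⟩ | ⟨rfl, rfl⟩ <;>
      simp [attachTwin, SimpleGraph.edge_adj]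
  exact ⟨hp _ _ ha hi this, hp _ _ hi ha this.symm⟩

/-- The old vertices stay linked: the edges `xy` and `zw` are replaced by paths through the new
vertices, and a path that is broken costs a vertex of `S`, which pays for deleting the edge. -/
lemma attachTwin_linked_inl {V : Type*} [Fintype V] {H : SimpleGraph V} {x y z w : V}
    (h : IsKConnected 3 (H ⊔ SimpleGraph.edge x y ⊔ SimpleGraph.edge z w))
    {S : Finset (V ⊕ Fin 8)} (hS : S.card < 3) {p : V ⊕ Fin 8 → Prop}
    (hp : ∀ a b, a ∉ S → b ∉ S → (attachTwin H y w ⊔ SimpleGraph.edge (.inl x) (.inr 0) ⊔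
      SimpleGraph.edge (.inl z) (.inr 4)).Adj a b → p a → p b)
    {a b : V} (ha : Sum.inl a ∉ S) (hb : Sum.inl b ∉ S) : p (.inl a) → p (.inl b) := by
  classical
  have hA : IsKConnected 2 (H ⊔ SimpleGraph.edge x y) := h.of_sup_edge
  have hB : IsKConnected 2 (H ⊔ SimpleGraph.edge z w) := by
    rw [sup_right_comm] at h
    exact h.of_sup_edge
  have hC : IsKConnected 1 H := hA.of_sup_edge
  rw [isKConnected_iff] at *
  have hcard : S.toLeft.card + S.toRight.card = S.card := S.card_toLeft_add_card_toRight
  have link := attachTwin_link hp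
  have adjK : ∀ i j : Fin 8, twinK4.Adj i j → Sum.inr i ∉ S → Sum.inr j ∉ S →
      p (.inr i) → p (.inr j) := fun i j hij hi hj =>
    hp _ _ hi hj (by simp [attachTwin, hij])
  have adjH : ∀ a b, H.Adj a b → Sum.inl a ∉ S → Sum.inl b ∉ S →
      (p (.inl a) → p (.inl b)) := fun a b hab ha hb =>
    hp _ _ ha hb (by simp [attachTwin, hab])
  have pathXY : Sum.inr 0 ∉ S → Sum.inr 1 ∉ S → Sum.inl x ∉ S → Sum.inl y ∉ S →
      (p (.inl x) ↔ p (.inl y)) := by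
    intro h0 h1 hx hy
    rw [link x 0 (by simp) hx h0, link y 1 (by simp) hy h1]
    exact ⟨adjK 0 1 (by decide) h0 h1, adjK 1 0 (by decide) h1 h0⟩
  have pathZW : Sum.inr 4 ∉ S → Sum.inr 5 ∉ S → Sum.inl z ∉ S → Sum.inl w ∉ S →
      (p (.inl z) ↔ p (.inl w)) := by
    intro h0 h1 hx hy
    rw [link z 4 (by simp) hx h0, link w 5 (by simp) hy h1]
    exact ⟨adjK 4 5 (by decide) h0 h1, adjK 5 4 (by decide) h1 h0⟩
  by_cases hP : Sum.inr 0 ∉ S ∧ Sum.inr 1 ∉ S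
  · by_cases hQ : Sum.inr 4 ∉ S ∧ Sum.inr 5 ∉ S
    · refine h.2 S.toLeft (by omega) (fun a => p (.inl a)) ?_ a b (by simpa) (by simpa)
      intro c d hc hd hcd
      simp only [Finset.mem_toLeft] at hc hd
      simp only [SimpleGraph.sup_adj, SimpleGraph.edge_adj] at hcd
      rcases hcd with (hcd | ⟨⟨rfl, rfl⟩ | ⟨rfl, rfl⟩, -⟩) | ⟨⟨rfl, rfl⟩ | ⟨rfl, rfl⟩, -⟩
      · exact adjH c d hcd hc hd
      · exact (pathXY hP.1 hP.2 hc hd).1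
      · exact (pathXY hP.1 hP.2 hd hc).2
      · exact (pathZW hQ.1 hQ.2 hc hd).1
      · exact (pathZW hQ.1 hQ.2 hd hc).2
    · have : S.toRight.Nonempty := by
        by_contra hne
        simp only [Finset.not_nonempty_iff_eq_empty] at hne
        simp [← Finset.mem_toRight, hne] at hQ
      have := this.card_pos
      refine hA.2 S.toLeft (by omega) (fun a => p (.inl a)) ?_ a b (by simpa) (by simpa)
      intro c d hc hd hcd
      simp only [Finset.mem_toLeft] at hc hd
      simp only [SimpleGraph.sup_adj, SimpleGraph.edge_adj] at hcd
      rcases hcd with hcd | ⟨⟨rfl, rfl⟩ | ⟨rfl, rfl⟩, -⟩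
      · exact adjH c d hcd hc hd
      · exact (pathXY hP.1 hP.2 hc hd).1
      · exact (pathXY hP.1 hP.2 hd hc).2
  · by_cases hQ : Sum.inr 4 ∉ S ∧ Sum.inr 5 ∉ S
    · have : S.toRight.Nonempty := by
        by_contra hne
        simp only [Finset.not_nonempty_iff_eq_empty] at hne
        simp [← Finset.mem_toRight, hne] at hP
      have := this.card_pos
      refine hB.2 S.toLeft (by omega) (fun a => p (.inl a)) ?_ a b (by simpa) (by simpa)
      intro c d hc hd hcd
      simp only [Finset.mem_toLeft] at hc hd
      simp only [SimpleGraph.sup_adj, SimpleGraph.edge_adj] at hcd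
      rcases hcd with hcd | ⟨⟨rfl, rfl⟩ | ⟨rfl, rfl⟩, -⟩
      · exact adjH c d hcd hc hd
      · exact (pathZW hQ.1 hQ.2 hc hd).1
      · exact (pathZW hQ.1 hQ.2 hd hc).2
    · have : 1 < S.toRight.card := by
        have h01 : Sum.inr 0 ∈ S ∨ Sum.inr 1 ∈ S := by tauto
        have h45 : Sum.inr 4 ∈ S ∨ Sum.inr 5 ∈ S := by tauto
        simp only [← Finset.mem_toRight] at h01 h45
        rcases h01 with h | h <;> rcases h45 with h' | h' <;>
          exact Finset.one_lt_card.2 ⟨_, h, _, h', by decide⟩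
      refine hC.2 S.toLeft (by omega) (fun a => p (.inl a)) ?_ a b (by simpa) (by simpa)
      intro c d hc hd hcd
      simp only [Finset.mem_toLeft] at hc hd
      exact adjH c d hcd hc hd

/-- Each surviving new vertex is tied to a surviving old one. The link `2 - 6` serves when both
vertices of `S` are spent on cutting one copy of `K₄` off from the old vertices. -/
lemma attachTwin_tie_inr {V : Type*} {H : SimpleGraph V} {x y z w : V}
    (hxy : x ≠ y) (hzw : z ≠ w) (h1 : ¬(x = z ∧ y = w)) (h2 : ¬(x = w ∧ y = z))
    {S : Finset (V ⊕ Fin 8)} (hS : S.card < 3) {p : V ⊕ Fin 8 → Prop}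
    (hp : ∀ a b, a ∉ S → b ∉ S → (attachTwin H y w ⊔ SimpleGraph.edge (.inl x) (.inr 0) ⊔
      SimpleGraph.edge (.inl z) (.inr 4)).Adj a b → p a → p b)
    {i : Fin 8} (hi : Sum.inr i ∉ S) : ∃ a, Sum.inl a ∉ S ∧ (p (.inl a) ↔ p (.inr i)) := by
  classical
  have three : ∀ a ∈ S, ∀ b ∈ S, ∀ c ∈ S, a = b ∨ a = c ∨ b = c := by
    by_contra! hcon
    obtain ⟨a, ha, b, hb, c, hc, hne⟩ := hcon
    have := Finset.two_lt_card.2 ⟨a, ha, b, hb, c, hc, hne⟩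
    omega
  have link := attachTwin_link hp
  have adjK : ∀ i j : Fin 8, twinK4.Adj i j → Sum.inr i ∉ S → Sum.inr j ∉ S →
      p (.inr i) → p (.inr j) := fun i j hij hi hj =>
    hp _ _ hi hj (by simp [attachTwin, hij])
  have cliqueP : ∀ i j : Fin 8, i < 4 → j < 4 → Sum.inr i ∉ S → Sum.inr j ∉ S →
      (p (.inr i) ↔ p (.inr j)) := by
    intro i j hi hj hiS hjS
    by_cases hij : i = j
    · rw [hij]
    · have hadj : twinK4.Adj i j := by clear hiS hjS; revert i j; decide
      exact ⟨adjK i j hadj hiS hjS, adjK j i hadj.symm hjS hiS⟩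
  have cliqueQ : ∀ i j : Fin 8, ¬ i < 4 → ¬ j < 4 → Sum.inr i ∉ S → Sum.inr j ∉ S →
      (p (.inr i) ↔ p (.inr j)) := by
    intro i j hi hj hiS hjS
    by_cases hij : i = j
    · rw [hij]
    · have hadj : twinK4.Adj i j := by clear hiS hjS; revert i j; decide
      exact ⟨adjK i j hadj hiS hjS, adjK j i hadj.symm hjS hiS⟩
  have tieP : (∃ a i, i < 4 ∧ Sum.inl a ∉ S ∧ Sum.inr i ∉ S ∧ (p (.inl a) ↔ p (.inr i))) ∨
      ((Sum.inr 0 ∈ S ∨ Sum.inl x ∈ S) ∧ (Sum.inr 1 ∈ S ∨ Sum.inl y ∈ S)) := by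
    by_contra! hcon
    by_cases hx : Sum.inr 0 ∈ S ∨ Sum.inl x ∈ S
    · have := hcon.2 hx
      exact absurd (link y 1 (by simp) this.2 this.1) (by grind)
    · push Not at hx
      exact absurd (link x 0 (by simp) hx.2 hx.1) (by grind)
  have tieQ : (∃ a i, ¬ i < 4 ∧ Sum.inl a ∉ S ∧ Sum.inr i ∉ S ∧ (p (.inl a) ↔ p (.inr i))) ∨
      ((Sum.inr 4 ∈ S ∨ Sum.inl z ∈ S) ∧ (Sum.inr 5 ∈ S ∨ Sum.inl w ∈ S)) := by
    by_contra! hcon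
    by_cases hx : Sum.inr 4 ∈ S ∨ Sum.inl z ∈ S
    · have := hcon.2 hx
      exact absurd (link w 5 (by simp) this.2 this.1) (by grind)
    · push Not at hx
      exact absurd (link z 4 (by simp) hx.2 hx.1) (by grind)
  have link26 : Sum.inr 2 ∉ S → Sum.inr 6 ∉ S → (p (.inr 2) ↔ p (.inr 6)) := fun h2 h6 =>
    ⟨adjK 2 6 (by decide) h2 h6, adjK 6 2 (by decide) h6 h2⟩
  rcases tieP with ⟨a, j, hj, ha, hjS, hp1⟩ | ⟨hb1, hb2⟩
  · by_cases hi4 : i < 4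
    · exact ⟨a, ha, hp1.trans (cliqueP j i hj hi4 hjS hi)⟩
    · rcases tieQ with ⟨b, k, hk, hb, hkS, hp2⟩ | ⟨hb1, hb2⟩
      · exact ⟨b, hb, hp2.trans (cliqueQ k i hk hi4 hkS hi)⟩
      · have h2S : Sum.inr 2 ∉ S := by
          intro h
          rcases hb1 with h' | h' <;> rcases hb2 with h'' | h'' <;>
            simpa only [Sum.inl.injEq, Sum.inr.injEq, reduceCtorEq, Fin.reduceEq, or_self, hzw]
              using three _ h _ h' _ h''
        have h6S : Sum.inr 6 ∉ S := by
          intro h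
          rcases hb1 with h' | h' <;> rcases hb2 with h'' | h'' <;>
            simpa only [Sum.inl.injEq, Sum.inr.injEq, reduceCtorEq, Fin.reduceEq, or_self, hzw]
              using three _ h _ h' _ h''
        exact ⟨a, ha, hp1.trans ((cliqueP j 2 hj (by decide) hjS h2S).trans
          ((link26 h2S h6S).trans (cliqueQ 6 i (by decide) hi4 h6S hi)))⟩
  · rcases tieQ with ⟨b, k, hk, hb, hkS, hp2⟩ | ⟨hb3, hb4⟩
    · by_cases hi4 : i < 4
      · have h2S : Sum.inr 2 ∉ S := by
          intro h
          rcases hb1 with h' | h' <;> rcases hb2 with h'' | h'' <;>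
            simpa only [Sum.inl.injEq, Sum.inr.injEq, reduceCtorEq, Fin.reduceEq, or_self, hxy]
              using three _ h _ h' _ h''
        have h6S : Sum.inr 6 ∉ S := by
          intro h
          rcases hb1 with h' | h' <;> rcases hb2 with h'' | h'' <;>
            simpa only [Sum.inl.injEq, Sum.inr.injEq, reduceCtorEq, Fin.reduceEq, or_self, hxy]
              using three _ h _ h' _ h''
        exact ⟨b, hb, hp2.trans ((cliqueQ k 6 hk (by decide) hkS h6S).trans
          ((link26 h2S h6S).symm.trans (cliqueP 2 i (by decide) hi4 h2S hi)))⟩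
      · exact ⟨b, hb, hp2.trans (cliqueQ k i hk hi4 hkS hi)⟩
    · exfalso
      rcases hb1 with e1 | e1 <;> rcases hb2 with e2 | e2 <;> rcases hb3 with e3 | e3 <;>
        rcases hb4 with e4 | e4 <;>
        (have t1 := three _ e1 _ e2 _ e3
         have t2 := three _ e1 _ e2 _ e4
         have t3 := three _ e1 _ e3 _ e4
         have t4 := three _ e2 _ e3 _ e4
         simp only [Sum.inl.injEq, Sum.inr.injEq, reduceCtorEq, Fin.reduceEq, false_or,
           or_false, hxy, hzw] at t1 t2 t3 t4 <;> grind only)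

/-- Two edges `xy` and `zw` of a 3-connected graph may be replaced by paths through two new copies
of `K₄` that are joined by an edge. -/
lemma isKConnected_attachTwin {V : Type*} [Fintype V] {H : SimpleGraph V} {x y z w : V}
    (hxy : x ≠ y) (hzw : z ≠ w) (h1 : ¬(x = z ∧ y = w)) (h2 : ¬(x = w ∧ y = z))
    (h : IsKConnected 3 (H ⊔ SimpleGraph.edge x y ⊔ SimpleGraph.edge z w)) :
    IsKConnected 3 (attachTwin H y w ⊔ SimpleGraph.edge (.inl x) (.inr 0) ⊔
      SimpleGraph.edge (.inl z) (.inr 4)) := by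
  rw [isKConnected_iff]
  refine ⟨by have := h.1; simp, fun S hS p hp => ?_⟩
  have old : ∀ a b, Sum.inl a ∉ S → Sum.inl b ∉ S → p (.inl a) → p (.inl b) :=
    fun a b ha hb => attachTwin_linked_inl h hS hp ha hb
  have new : ∀ i, Sum.inr i ∉ S → ∃ a, Sum.inl a ∉ S ∧ (p (.inl a) ↔ p (.inr i)) :=
    fun i hi => attachTwin_tie_inr hxy hzw h1 h2 hS hp hi
  rintro (a | i) (b | j) hu hv hpu
  · exact old a b hu hv hpu
  · obtain ⟨b, hb, hbj⟩ := new j hv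
    exact hbj.1 (old a b hu hb hpu)
  · obtain ⟨a, ha, hai⟩ := new i hu
    exact old a b ha hv (hai.2 hpu)
  · obtain ⟨b, hb, hbj⟩ := new j hv
    obtain ⟨a, ha, hai⟩ := new i hu
    exact hbj.1 (old a b ha hb (hai.2 hpu))

lemma ncard_edgeSet_sup_edge {V : Type*} [Finite V] {G : SimpleGraph V} {x y : V} (hxy : x ≠ y)
    (h : ¬G.Adj x y) : (G ⊔ SimpleGraph.edge x y).edgeSet.ncard = G.edgeSet.ncard + 1 := by
  have he : (SimpleGraph.edge x y).edgeSet = {s(x, y)} := by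
    rw [SimpleGraph.edgeSet_edge, sdiff_eq_left, Set.disjoint_singleton_left]
    simpa using hxy
  rw [SimpleGraph.edgeSet_sup, he, Set.union_singleton,
    Set.ncard_insert_of_notMem (by simpa using h)]

lemma ncard_edgeSet_twinK4 : twinK4.edgeSet.ncard = 13 := by
  rw [← SimpleGraph.coe_edgeFinset, Set.ncard_coe_finset]
  decide +kernel

lemma coveredByK4_twinK4 : CoveredByK4 twinK4 := by
  unfold CoveredByK4
  decide +kernel

/-- There is a graph `H` on `n` vertices, every vertex of which lies in a `K₄`, that becomes a
3-connected graph with `m` edges when two further edges are added. The two edges are those at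
which the construction can be continued. -/
def Growable (n m : ℕ) : Prop :=
  ∃ (V : Type) (_ : Fintype V) (H : SimpleGraph V) (x y z w : V), Fintype.card V = n ∧
    x ≠ y ∧ z ≠ w ∧ ¬(x = z ∧ y = w) ∧ ¬(x = w ∧ y = z) ∧ ¬H.Adj x y ∧ ¬H.Adj z w ∧
    CoveredByK4 H ∧ IsKConnected 3 (H ⊔ SimpleGraph.edge x y ⊔ SimpleGraph.edge z w) ∧
    H.edgeSet.ncard + 2 = m

lemma CoveredByK4.mono {V : Type*} {G H : SimpleGraph V} (hGH : G ≤ H) (h : CoveredByK4 G) :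
    CoveredByK4 H := by
  intro v
  obtain ⟨a, b, c, h1, h2, h3, h4, h5, h6⟩ := h v
  exact ⟨a, b, c, hGH h1, hGH h2, hGH h3, hGH h4, hGH h5, hGH h6⟩

lemma CoveredByK4.sum {V W : Type*} {G : SimpleGraph V} {H : SimpleGraph W}
    (hG : CoveredByK4 G) (hH : CoveredByK4 H) : CoveredByK4 (G ⊕g H) := by
  rintro (v | v)
  · obtain ⟨a, b, c, h⟩ := hG v
    exact ⟨.inl a, .inl b, .inl c, by simpa using h⟩
  · obtain ⟨a, b, c, h⟩ := hH v
    exact ⟨.inr a, .inr b, .inr c, by simpa using h⟩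

lemma Growable.add_eight {n m : ℕ} (h : Growable n m) : Growable (n + 8) (m + 15) := by
  obtain ⟨V, _, H, x, y, z, w, hn, hxy, hzw, h1, h2, hHxy, hHzw, hK, hc, hm⟩ := h
  refine ⟨V ⊕ Fin 8, inferInstance, attachTwin H y w, .inl x, .inr 0, .inl z, .inr 4,
    by simp [hn], by simp, by simp, by simp, by simp, ?_, ?_, ?_,
    isKConnected_attachTwin hxy hzw h1 h2 hc, ?_⟩
  · simp [attachTwin, SimpleGraph.edge_adj]
  · simp [attachTwin, SimpleGraph.edge_adj]
  · exact (hK.sum coveredByK4_twinK4).mono (le_sup_left.trans le_sup_left)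
  · have hsum : (H ⊕g twinK4).edgeSet.ncard = H.edgeSet.ncard + 13 := by
      rw [← ncard_edgeSet_twinK4, ← Nat.card_coe_set_eq,
        Nat.card_congr SimpleGraph.edgeSetSumEquiv, Nat.card_sum, Nat.card_coe_set_eq,
        Nat.card_coe_set_eq]
    rw [attachTwin, ncard_edgeSet_sup_edge (by simp), ncard_edgeSet_sup_edge (by simp), hsum]
    · omega
    · simp
    · simp [SimpleGraph.edge_adj]

/-! ### Small graphs and the upper bound -/

/-- One round of a search in `G - S`, for a graph `G` with list of edges `E`. The set of vertices
reached, stored as the binary digits of `m`, gains both ends of each edge of `G - S` that has an end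
in it. -/
def searchRound {n : ℕ} (E : List (Fin n × Fin n)) (S : List (Fin n)) (m : ℕ) : ℕ :=
  E.foldl (fun m e => if (m.testBit e.1 || m.testBit e.2) && !S.contains e.1 && !S.contains e.2
    then m ||| 2 ^ e.1.1 ||| 2 ^ e.2.1 else m) m

/-- Five rounds of search, started at some vertex outside `S`, reach all vertices outside `S`. Five
rounds suffice for the graphs considered here. -/
def searchSucceeds {n : ℕ} (E : List (Fin n × Fin n)) (S : List (Fin n)) : Bool :=
  match (List.finRange n).find? (fun r => !S.contains r) with
  | none => true
  | some r => (List.finRange n).all fun v =>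
      S.contains v || ((searchRound E S)^[5] (2 ^ r.1)).testBit v

lemma searchRound_sound {n : ℕ} {G : SimpleGraph (Fin n)} {E : List (Fin n × Fin n)}
    (hE : ∀ e ∈ E, G.Adj e.1 e.2) {S : List (Fin n)} {p : Fin n → Prop}
    (hp : ∀ a b, a ∉ S → b ∉ S → G.Adj a b → p a → p b) {m : ℕ}
    (hm : ∀ i : Fin n, m.testBit i → p i) (i : Fin n) (hi : (searchRound E S m).testBit i) :
    p i := by
  induction E generalizing m with
  | nil => exact hm i hi
  | cons e E ih =>
    refine ih (fun e' he' => hE e' (List.mem_cons_of_mem _ he')) ?_ hi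
    intro j hj
    have hadj := hE e List.mem_cons_self
    beta_reduce at hj
    split_ifs at hj with hc
    · simp only [Bool.and_eq_true, Bool.or_eq_true, Bool.not_eq_true', List.contains_eq_mem,
        decide_eq_false_iff_not] at hc
      simp only [Nat.testBit_or, Nat.testBit_two_pow, Bool.or_eq_true, decide_eq_true_eq,
        ← Fin.ext_iff] at hj
      obtain ⟨⟨h1, h2⟩, h3⟩ := hc
      rcases hj with (hj | rfl) | rfl
      · exact hm j hj
      · exact h1.elim (fun h => hm _ h) (fun h => hp _ _ h3 h2 hadj.symm (hm _ h))
      · exact h1.elim (fun h => hp _ _ h2 h3 hadj (hm _ h)) (fun h => hm _ h)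
    · exact hm j hj

lemma linkedOutside_of_searchSucceeds {n : ℕ} {G : SimpleGraph (Fin n)} {E : List (Fin n × Fin n)}
    (hE : ∀ e ∈ E, G.Adj e.1 e.2) {S : List (Fin n)} (h : searchSucceeds E S) :
    LinkedOutside G S.toFinset := by
  intro p hp u v hu hv hpu
  simp only [List.mem_toFinset] at hp hu hv
  unfold searchSucceeds at h
  split at h
  next hr => simp at hr; exact absurd (hr u) hu
  next r hr =>
    have hr := List.find?_some hr
    simp only [List.all_eq_true, List.mem_finRange, forall_const, Bool.or_eq_true,
      List.contains_eq_mem, decide_eq_true_eq] at h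
    have key : ∀ q : Fin n → Prop, (∀ a b, a ∉ S → b ∉ S → G.Adj a b → q a → q b) → q r →
        ∀ v, v ∉ S → q v := by
      intro q hq hqr v hv
      have : ∀ k, ∀ i : Fin n, ((searchRound E S)^[k] (2 ^ r.1)).testBit i → q i := by
        intro k
        induction k with
        | zero =>
          intro i hi
          simp only [Function.iterate_zero, id, Nat.testBit_two_pow, decide_eq_true_eq,
            ← Fin.ext_iff] at hi
          exact hi ▸ hqr
        | succ k ih =>
          intro i hi
          rw [Function.iterate_succ_apply'] at hi
          exact searchRound_sound hE hq ih i hi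
      exact this 5 v ((h v).resolve_left hv)
    by_cases hpr : p r
    · exact key p hp hpr v hv
    · exact absurd hpu (key (fun a => ¬p a)
        (fun a b ha hb hab hna hpb => hna (hp b a hb ha hab.symm hpb)) hpr u hu)

lemma isKConnected_three_of_search {n : ℕ} {G : SimpleGraph (Fin n)} {E : List (Fin n × Fin n)}
    (hn : 3 < n) (hE : ∀ e ∈ E, G.Adj e.1 e.2) (h0 : searchSucceeds E [])
    (h : ∀ a b, searchSucceeds E [a, b]) : IsKConnected 3 G := by
  rw [isKConnected_iff]
  refine ⟨by simpa using hn, fun S hS => ?_⟩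
  have hS' : S = ∅ ∨ ∃ a b, S = {a, b} := by
    interval_cases hc : S.card
    · exact .inl (Finset.card_eq_zero.1 hc)
    · obtain ⟨a, rfl⟩ := Finset.card_eq_one.1 hc
      exact .inr ⟨a, a, by simp⟩
    · obtain ⟨a, b, -, rfl⟩ := Finset.card_eq_two.1 hc
      exact .inr ⟨a, b, rfl⟩
  rcases hS' with rfl | ⟨a, b, rfl⟩
  · simpa using linkedOutside_of_searchSucceeds hE h0
  · simpa using linkedOutside_of_searchSucceeds hE (h a b)

/-- The conditions of `Growable` for an explicit graph, in a form that can be decided. -/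
lemma growable_listGraph {n m : ℕ} {E : List (Fin n × Fin n)} {x y z w : Fin n} (hn : 3 < n)
    (hadj : x ≠ y ∧ z ≠ w ∧ ¬(x = z ∧ y = w) ∧ ¬(x = w ∧ y = z) ∧ ¬(listGraph E).Adj x y ∧
      ¬(listGraph E).Adj z w)
    (hE : ∀ e ∈ E, e.1 ≠ e.2)
    (hK : ∀ v, ∃ a, (listGraph E).Adj v a ∧ ∃ b, (listGraph E).Adj v b ∧ (listGraph E).Adj a b ∧
      ∃ c, (listGraph E).Adj v c ∧ (listGraph E).Adj a c ∧ (listGraph E).Adj b c)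
    (h0 : searchSucceeds ((x, y) :: (z, w) :: E) [])
    (h2 : ∀ a b, searchSucceeds ((x, y) :: (z, w) :: E) [a, b])
    (hm : (listGraph E).edgeFinset.card + 2 = m) : Growable n m := by
  obtain ⟨hxy, hzw, h3, h4, h5, h6⟩ := hadj
  refine ⟨Fin n, inferInstance, listGraph E, x, y, z, w, by simp, hxy, hzw, h3, h4, h5, h6, ?_,
    isKConnected_three_of_search hn ?_ h0 h2, ?_⟩
  · intro v
    obtain ⟨a, ha, b, hb, hab, c, hc, hac, hbc⟩ := hK v
    exact ⟨a, b, c, ha, hb, hc, hab, hac, hbc⟩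
  · intro e he
    simp only [List.mem_cons] at he
    simp only [SimpleGraph.sup_adj, SimpleGraph.edge_adj]
    rcases he with rfl | rfl | he
    · exact .inl (.inr (by simpa using hxy))
    · exact .inr (by simpa using hzw)
    · exact .inl (.inl ⟨hE e he, .inl he⟩)
  · rw [← hm, ← SimpleGraph.coe_edgeFinset, Set.ncard_coe_finset]

lemma growable_eight : Growable 8 15 :=
  growable_listGraph (E := pairs 0 1 2 3 ++ pairs 4 5 6 7 ++ [(2, 6)])
    (x := 0) (y := 4) (z := 1) (w := 5)
    (by decide +kernel) (by decide +kernel) (by decide +kernel) (by decide +kernel)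
    (by decide +kernel) (by decide +kernel) (by decide +kernel)

lemma growable_nine : Growable 9 18 :=
  growable_listGraph (E := pairs 0 1 2 3 ++ pairs 4 5 6 7 ++ [(2, 6), (4, 8), (5, 8), (6, 8)])
    (x := 0) (y := 4) (z := 1) (w := 5)
    (by decide +kernel) (by decide +kernel) (by decide +kernel) (by decide +kernel)
    (by decide +kernel) (by decide +kernel) (by decide +kernel)

lemma growable_ten : Growable 10 20 :=
  growable_listGraph (E := pairs 0 1 2 3 ++ pairs 2 3 4 5 ++ pairs 6 7 8 9 ++ [(1, 8)])
    (x := 0) (y := 6) (z := 4) (w := 7)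
    (by decide +kernel) (by decide +kernel) (by decide +kernel) (by decide +kernel)
    (by decide +kernel) (by decide +kernel) (by decide +kernel)

lemma growable_eleven : Growable 11 22 :=
  growable_listGraph (E := pairs 0 1 2 3 ++ pairs 3 4 5 6 ++ pairs 7 8 9 10 ++ [(1, 5), (2, 9)])
    (x := 0) (y := 7) (z := 4) (w := 8)
    (by decide +kernel) (by decide +kernel) (by decide +kernel) (by decide +kernel)
    (by decide +kernel) (by decide +kernel) (by decide +kernel)

lemma growable_twelve : Growable 12 23 :=
  growable_listGraph (E := pairs 0 1 2 3 ++ pairs 4 5 6 7 ++ pairs 8 9 10 11 ++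
    [(2, 9), (5, 10), (6, 11)])
    (x := 0) (y := 4) (z := 1) (w := 8)
    (by decide +kernel) (by decide +kernel) (by decide +kernel) (by decide +kernel)
    (by decide +kernel) (by decide +kernel) (by decide +kernel)

lemma growable_thirteen : Growable 13 26 :=
  growable_listGraph (E := pairs 0 1 2 3 ++ pairs 4 5 6 7 ++ pairs 8 9 10 11 ++
    [(2, 9), (5, 10), (6, 11), (0, 12), (1, 12), (2, 12)])
    (x := 0) (y := 4) (z := 1) (w := 8)
    (by decide +kernel) (by decide +kernel) (by decide +kernel) (by decide +kernel)
    (by decide +kernel) (by decide +kernel) (by decide +kernel)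

lemma growable_fourteen : Growable 14 28 :=
  growable_listGraph (E := pairs 0 1 2 3 ++ pairs 2 3 4 5 ++ pairs 6 7 8 9 ++ pairs 10 11 12 13 ++
    [(4, 11), (7, 12), (8, 13)])
    (x := 0) (y := 6) (z := 1) (w := 10)
    (by decide +kernel) (by decide +kernel) (by decide +kernel) (by decide +kernel)
    (by decide +kernel) (by decide +kernel) (by decide +kernel)

lemma growable_fifteen : Growable 15 29 :=
  growable_listGraph (E := pairs 0 1 2 3 ++ pairs 3 4 5 6 ++ pairs 7 8 9 10 ++ pairs 11 12 13 14 ++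
    [(4, 8), (5, 12), (9, 13)])
    (x := 0) (y := 7) (z := 1) (w := 11)
    (by decide +kernel) (by decide +kernel) (by decide +kernel) (by decide +kernel)
    (by decide +kernel) (by decide +kernel) (by decide +kernel)

lemma growable_minSizeFormula (n : ℕ) (hn : 8 ≤ n) : Growable n (minSizeFormula n) := by
  induction n using Nat.strong_induction_on with
  | _ n ih =>
    by_cases h : n < 16
    · interval_cases n
      · exact growable_eight
      · exact growable_nine
      · exact growable_ten
      · exact growable_eleven
      · exact growable_twelve
      · exact growable_thirteen
      · exact growable_fourteen
      · exact growable_fifteen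
    · obtain ⟨k, rfl⟩ : ∃ k, n = k + 8 := ⟨n - 8, by omega⟩
      have : minSizeFormula (k + 8) = minSizeFormula k + 15 := by
        unfold minSizeFormula
        split_ifs <;> omega
      rw [this]
      exact (ih k (by omega) (by omega)).add_eight

lemma exists_size_minSizeFormula {V : Type*} [Fintype V] (hV : 8 ≤ Fintype.card V) :
    ∃ G : SimpleGraph V, IsKConnected 3 G ∧ LocallyNonforesty G ∧
      G.edgeSet.ncard = minSizeFormula (Fintype.card V) := by
  obtain ⟨W, _, H, x, y, z, w, hn, hxy, hzw, h1, h2, hHxy, hHzw, hK, hc, hm⟩ :=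
    growable_minSizeFormula _ hV
  let e : V ≃ W := Fintype.equivOfCardEq hn.symm
  let H' := H ⊔ SimpleGraph.edge x y ⊔ SimpleGraph.edge z w
  let i : H'.comap e ≃g H' := SimpleGraph.Iso.comap e H'
  refine ⟨H'.comap e, hc.iso i.symm,
    (hK.mono (le_sup_left.trans le_sup_left)).locallyNonforesty.iso i.symm, ?_⟩
  rw [← Nat.card_coe_set_eq, Nat.card_congr i.mapEdgeSet, Nat.card_coe_set_eq,
    ncard_edgeSet_sup_edge hzw, ncard_edgeSet_sup_edge hxy hHxy]
  · omega
  · simp only [SimpleGraph.sup_adj, SimpleGraph.edge_adj]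
    grind

/-! ### Small cuts and minimum degree -/

/-- In a 3-connected graph, a set `X` whose neighbours outside `X` lie in a set `C` of at most two
vertices is everything up to `C`. -/
lemma IsKConnected.card_le_of_cut {V : Type*} [Fintype V] [DecidableEq V] {G : SimpleGraph V}
    (hG : IsKConnected 3 G) (X C : Finset V) (hC : C.card ≤ 2)
    {x : V} (hx : x ∈ X) (hxC : x ∉ C) (h : ∀ x ∈ X, ∀ y, G.Adj x y → y ∈ X ∨ y ∈ C) :
    Fintype.card V ≤ (X ∪ C).card := by
  rw [isKConnected_iff] at hG
  refine Finset.card_le_card fun v _ => ?_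
  by_contra hv
  simp only [Finset.mem_union, not_or] at hv
  exact hv.1 (hG.2 C (by omega) (· ∈ X)
    (fun a b ha hb hab haX => (h a haX b hab).resolve_right hb) x v hxC hv.2 hx)

lemma three_le_card_core {V : Type*} {G : SimpleGraph V} {C : Finset V} (hC : C.Nonempty)
    (h : ∀ x ∈ C, ∃ a ∈ C, ∃ b ∈ C, a ≠ b ∧ G.Adj x a ∧ G.Adj x b) : 3 ≤ C.card := by
  classical
  obtain ⟨x, hx⟩ := hC
  obtain ⟨a, ha, b, hb, hab, hxa, hxb⟩ := h x hx
  exact Finset.two_lt_card.2 ⟨x, hx, a, ha, b, hb, hxa.ne, hxb.ne, hab⟩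

section LowerBound

variable {V : Type*} [Fintype V] {G : SimpleGraph V} [DecidableRel G.Adj]

lemma LocallyNonforesty.three_le_degree (hL : LocallyNonforesty G) (v : V) : 3 ≤ G.degree v := by
  obtain ⟨C, hC, hCv, h⟩ := hL.exists_core v
  exact (three_le_card_core hC h).trans
    (Finset.card_le_card fun x hx => (G.mem_neighborFinset v x).2 (hCv x hx))

lemma eq_neighborFinset_of_card {v : V} {s : Finset V} (hs : ∀ x ∈ s, G.Adj v x)
    (hc : G.degree v ≤ s.card) (y : V) (hy : G.Adj v y) : y ∈ s := by
  have : s = G.neighborFinset v := Finset.eq_of_subset_of_card_le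
    (fun x hx => (G.mem_neighborFinset v x).2 (hs x hx)) hc
  rw [this]
  exact (G.mem_neighborFinset v y).2 hy

/-- The neighbours of degree three of a vertex. -/
def cubicNeighbors (G : SimpleGraph V) [DecidableRel G.Adj] (v : V) : Finset V :=
  (G.neighborFinset v).filter fun u => G.degree u = 3

lemma mem_cubicNeighbors {v u : V} : u ∈ cubicNeighbors G v ↔ G.Adj v u ∧ G.degree u = 3 := by
  simp [cubicNeighbors]

/-! ### The charge of a vertex -/

/-- Four times the degree of `v` minus fifteen, after each vertex of degree three has received
`1` from each of its neighbours. -/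
def charge (G : SimpleGraph V) [DecidableRel G.Adj] (v : V) : ℤ :=
  4 * G.degree v - 15 - (cubicNeighbors G v).card + if G.degree v = 3 then 3 else 0

lemma sum_charge : ∑ v, charge G v = 8 * G.edgeFinset.card - 15 * Fintype.card V := by
  have h1 : ∑ v, (G.degree v : ℤ) = 2 * G.edgeFinset.card := by
    exact_mod_cast G.sum_degrees_eq_twice_card_edges
  have h2 : ∑ v, ((cubicNeighbors G v).card : ℤ) = ∑ v, if G.degree v = 3 then 3 else 0 := by
    have (v : V) : ((cubicNeighbors G v).card : ℤ) =
        ∑ u, if G.Adj v u ∧ G.degree u = 3 then 1 else 0 := by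
      rw [Finset.sum_boole]
      congr 2
      ext u
      simp [mem_cubicNeighbors]
    simp_rw [this]
    rw [Finset.sum_comm]
    refine Finset.sum_congr rfl fun u _ => ?_
    split_ifs with hu
    · have h3 : ((G.neighborFinset u).card : ℤ) = 3 := by
        rw [G.card_neighborFinset_eq_degree, hu]; rfl
      rw [Finset.sum_boole, ← h3]
      congr 2
      ext v
      simp [hu, G.adj_comm]
    · simp [hu]
  simp only [charge, Finset.sum_add_distrib, Finset.sum_sub_distrib, ← Finset.mul_sum, h1, h2]
  simp
  ring

lemma charge_of_degree_ne_three {v : V} (hv : G.degree v ≠ 3) :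
    charge G v = 4 * G.degree v - 15 - (cubicNeighbors G v).card := by
  simp [charge, hv]

/-! ### Vertices of degree three in 3-connected graphs -/

variable [DecidableEq V]

lemma LocallyNonforesty.adj_of_degree_eq_three (hL : LocallyNonforesty G) {v a b : V}
    (hv : G.degree v = 3) (ha : G.Adj v a) (hb : G.Adj v b) (hab : a ≠ b) : G.Adj a b := by
  obtain ⟨C, hC, hCv, h⟩ := hL.exists_core v
  have h3 := three_le_card_core hC h
  have hCN := eq_neighborFinset_of_card hCv (hv.trans_le h3)
  have hC3 : C.card ≤ 3 :=
    hv ▸ Finset.card_le_card fun x hx => (G.mem_neighborFinset v x).2 (hCv x hx)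
  obtain ⟨p, hp, q, hq, hpq, hap, haq⟩ := h a (hCN a ha)
  by_contra hnab
  have : ({a, b, p, q} : Finset V).card ≤ C.card := Finset.card_le_card (by
    intro x hx
    simp only [Finset.mem_insert, Finset.mem_singleton] at hx
    rcases hx with rfl | rfl | rfl | rfl
    exacts [hCN _ ha, hCN _ hb, hp, hq])
  rw [Finset.card_eq_of_equiv_fin (n := 4) ?_] at this
  · omega
  · refine Finset.equivFinOfCardEq ?_
    rw [Finset.card_insert_of_notMem, Finset.card_insert_of_notMem, Finset.card_pair hpq]
    · simp only [Finset.mem_insert, Finset.mem_singleton]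
      rintro (rfl | rfl) <;> contradiction
    · simp only [Finset.mem_insert, Finset.mem_singleton]
      rintro (rfl | rfl | rfl)
      exacts [hab rfl, hap.ne rfl, haq.ne rfl]

lemma LocallyNonforesty.exists_of_degree_eq_three (hL : LocallyNonforesty G) {v a : V}
    (hv : G.degree v = 3) (ha : G.Adj v a) :
    ∃ b c, G.Adj v b ∧ G.Adj v c ∧ G.Adj a b ∧ G.Adj a c ∧ G.Adj b c ∧
      ∀ y, G.Adj v y → y = a ∨ y = b ∨ y = c := by
  have h2 : ((G.neighborFinset v).erase a).card = 2 := by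
    rw [Finset.card_erase_of_mem ((G.mem_neighborFinset v a).2 ha), G.card_neighborFinset_eq_degree,
      hv]
  obtain ⟨b, c, hbc, heq⟩ := Finset.card_eq_two.1 h2
  have hb : b ∈ (G.neighborFinset v).erase a := by simp [heq]
  have hc : c ∈ (G.neighborFinset v).erase a := by simp [heq]
  simp only [Finset.mem_erase, SimpleGraph.mem_neighborFinset] at hb hc
  refine ⟨b, c, hb.2, hc.2, hL.adj_of_degree_eq_three hv ha hb.2 hb.1.symm,
    hL.adj_of_degree_eq_three hv ha hc.2 hc.1.symm, hL.adj_of_degree_eq_three hv hb.2 hc.2 hbc, ?_⟩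
  intro y hy
  by_cases hya : y = a
  · exact .inl hya
  · have : y ∈ (G.neighborFinset v).erase a := by simp [hya, hy]
    rw [heq] at this
    simpa [hya] using this

lemma not_adj_of_degree_eq_three (hG : IsKConnected 3 G) (hL : LocallyNonforesty G)
    (hn : 8 ≤ Fintype.card V) {u v : V} (hu : G.degree u = 3) (hv : G.degree v = 3) :
    ¬G.Adj u v := by
  intro huv
  obtain ⟨b, c, hub, huc, hvb, hvc, hbc, hN⟩ := hL.exists_of_degree_eq_three hu huv
  have hNv := eq_neighborFinset_of_card (G := G) (v := v) (s := {u, b, c})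
    (by simp [huv.symm, hvb, hvc])
    (by rw [hv, Finset.card_eq_three.2 ⟨u, b, c, hub.ne, huc.ne, hbc.ne, rfl⟩])
  have := hG.card_le_of_cut {u, v} {b, c} Finset.card_le_two (x := u) (by simp)
    (by simp [hub.ne, huc.ne]) (by
      simp only [Finset.mem_insert, Finset.mem_singleton] at hNv ⊢
      rintro x (rfl | rfl) y hxy
      · have := hN y hxy; tauto
      · have := hNv y hxy; tauto)
  have := Finset.card_union_le {u, v} {b, c}
  have := Finset.card_le_two (a := u) (b := v)
  have := Finset.card_le_two (a := b) (b := c)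
  omega

lemma cubicNeighbors_eq_empty (hG : IsKConnected 3 G) (hL : LocallyNonforesty G)
    (hn : 8 ≤ Fintype.card V) {v : V} (hv : G.degree v = 3) : cubicNeighbors G v = ∅ := by
  refine Finset.eq_empty_of_forall_notMem fun u hu => ?_
  rw [mem_cubicNeighbors] at hu
  exact not_adj_of_degree_eq_three hG hL hn hv hu.2 hu.1

/-- A vertex with a neighbour of degree three has at least two neighbours of larger degree, and at
least three unless it is adjacent to all other vertices. -/
lemma card_cubicNeighbors_le (hG : IsKConnected 3 G) (hL : LocallyNonforesty G)
    (hn : 8 ≤ Fintype.card V) {a : V} (ha : (cubicNeighbors G a).Nonempty) :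
    (cubicNeighbors G a).card + 2 ≤ G.degree a ∧
      (G.degree a + 1 < Fintype.card V → (cubicNeighbors G a).card + 3 ≤ G.degree a) := by
  obtain ⟨v, hv⟩ := ha
  have hv' := mem_cubicNeighbors.1 hv
  obtain ⟨b, c, hvb, hvc, hab, hac, hbc, hN⟩ := hL.exists_of_degree_eq_three hv'.2 hv'.1.symm
  set R := G.neighborFinset a \ cubicNeighbors G a with hR
  have hsub : cubicNeighbors G a ⊆ G.neighborFinset a := Finset.filter_subset _ _
  have hcard : R.card + (cubicNeighbors G a).card = G.degree a := by
    rw [hR, Finset.card_sdiff_add_card_eq_card hsub, G.card_neighborFinset_eq_degree]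
  have hbR : b ∈ R := by
    simp only [hR, Finset.mem_sdiff, SimpleGraph.mem_neighborFinset, hab, mem_cubicNeighbors,
      true_and]
    exact fun hb => not_adj_of_degree_eq_three hG hL hn hv'.2 hb hvb
  have hcR : c ∈ R := by
    simp only [hR, Finset.mem_sdiff, SimpleGraph.mem_neighborFinset, hac, mem_cubicNeighbors,
      true_and]
    exact fun hb => not_adj_of_degree_eq_three hG hL hn hv'.2 hb hvc
  have h2 : 1 < R.card := Finset.one_lt_card.2 ⟨b, hbR, c, hcR, hbc.ne⟩
  refine ⟨by omega, fun hlt => ?_⟩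
  by_contra hcon
  have := hG.card_le_of_cut (insert a (cubicNeighbors G a)) R (by omega) (x := a) (by simp)
    (by simp [hR]) (by
      intro x hx y hxy
      have hNa : ∀ y, G.Adj a y → y ∈ insert a (cubicNeighbors G a) ∨ y ∈ R := by
        intro y hy
        by_cases h : y ∈ cubicNeighbors G a
        · simp [h]
        · simp [hR, h, hy]
      rcases Finset.mem_insert.1 hx with rfl | hx
      · exact hNa y hxy
      · have hx := mem_cubicNeighbors.1 hx
        by_cases hya : y = a
        · simp [hya]
        · exact hNa y (hL.adj_of_degree_eq_three hx.2 hx.1.symm hxy (Ne.symm hya)))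
  have h1 := Finset.card_union_le (insert a (cubicNeighbors G a)) R
  have h2 := Finset.card_insert_le a (cubicNeighbors G a)
  omega

lemma card_cubicNeighbors_le_one (hG : IsKConnected 3 G) (hL : LocallyNonforesty G)
    (hn : 8 ≤ Fintype.card V) {a : V} (ha : G.degree a = 4) : (cubicNeighbors G a).card ≤ 1 := by
  by_contra hcon
  have := (card_cubicNeighbors_le hG hL hn (a := a) (Finset.card_pos.1 (by omega))).2 (by omega)
  omega

lemma charge_of_degree_eq_three (hG : IsKConnected 3 G) (hL : LocallyNonforesty G)
    (hn : 8 ≤ Fintype.card V) {v : V} (hv : G.degree v = 3) : charge G v = 0 := by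
  simp [charge, hv, cubicNeighbors_eq_empty hG hL hn hv]

lemma charge_nonneg (hG : IsKConnected 3 G) (hL : LocallyNonforesty G)
    (hn : 8 ≤ Fintype.card V) (v : V) : 0 ≤ charge G v := by
  have h3 := hL.three_le_degree v
  by_cases hv : G.degree v = 3
  · rw [charge_of_degree_eq_three hG hL hn hv]
  rw [charge_of_degree_ne_three hv]
  by_cases h4 : G.degree v = 4
  · have := card_cubicNeighbors_le_one hG hL hn h4
    omega
  rcases (cubicNeighbors G v).eq_empty_or_nonempty with h | h
  · rw [h, Finset.card_empty]; omega
  · have := (card_cubicNeighbors_le hG hL hn h).1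
    omega

end LowerBound

/-! ### Graphs of small total charge -/

section SmallCharge

variable {V : Type*} [Fintype V] [DecidableEq V] {G : SimpleGraph V} [DecidableRel G.Adj]

lemma five_le_degree_of_two_cubic (hG : IsKConnected 3 G) (hL : LocallyNonforesty G)
    (hn : 8 ≤ Fintype.card V) {a v w : V} (hvw : v ≠ w) (hv : v ∈ cubicNeighbors G a)
    (hw : w ∈ cubicNeighbors G a) : 5 ≤ G.degree a := by
  have h2 : 1 < (cubicNeighbors G a).card := Finset.one_lt_card.2 ⟨v, hv, w, hw, hvw⟩
  have h3 := hL.three_le_degree a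
  by_contra hcon
  by_cases h : G.degree a = 3
  · rw [cubicNeighbors_eq_empty hG hL hn h] at h2
    simp at h2
  · have := card_cubicNeighbors_le_one hG hL hn (a := a) (by omega)
    omega

lemma sum_charge_le (hG : IsKConnected 3 G) (hL : LocallyNonforesty G)
    (hn : 8 ≤ Fintype.card V) (hs : ∑ v, charge G v ≤ 6) (A : Finset V) :
    ∑ v ∈ A, charge G v ≤ 6 :=
  (Finset.sum_le_sum_of_subset_of_nonneg (Finset.subset_univ A)
    fun v _ _ => charge_nonneg hG hL hn v).trans hs

lemma charge_of_five_le_degree (hG : IsKConnected 3 G) (hL : LocallyNonforesty G)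
    (hn : 8 ≤ Fintype.card V) (hs : ∑ v, charge G v ≤ 6) {a : V} (ha : 5 ≤ G.degree a) :
    (G.degree a = 5 ∧ 3 ≤ charge G a) ∨ (G.degree a = 6 ∧ charge G a = 6) := by
  have h1 : charge G a ≤ 6 := by simpa using sum_charge_le hG hL hn hs {a}
  rw [charge_of_degree_ne_three (by omega)] at h1 ⊢
  rcases (cubicNeighbors G a).eq_empty_or_nonempty with h | h
  · simp only [h, Finset.card_empty] at h1 ⊢
    omega
  · obtain ⟨h2, h3⟩ := card_cubicNeighbors_le hG hL hn h
    have := h3 (by omega)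
    omega

/-- If two cubic neighbours of `a` share a further neighbour `y`, the charge forces `a` and `y` to
have degree five, and then two vertices separate the graph. -/
lemma not_common_of_cubicNeighbors (hG : IsKConnected 3 G) (hL : LocallyNonforesty G)
    (hn : 8 ≤ Fintype.card V) (hs : ∑ v, charge G v ≤ 6) {a v w y : V} (hvw : v ≠ w)
    (hv : v ∈ cubicNeighbors G a) (hw : w ∈ cubicNeighbors G a)
    (hya : y ≠ a) (hvy : G.Adj v y) (hwy : G.Adj w y) : False := by
  have hav := mem_cubicNeighbors.1 hv
  have haw := mem_cubicNeighbors.1 hw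
  have ha5 := five_le_degree_of_two_cubic hG hL hn hvw hv hw
  have hca := charge_of_five_le_degree hG hL hn hs ha5
  have hnot : ∀ {u x}, G.degree u = 3 → G.Adj u x → G.degree x ≠ 3 := fun hu hux hx =>
    not_adj_of_degree_eq_three hG hL hn hu hx hux
  have hne : ∀ {u x : V}, G.degree u = 3 → G.degree x ≠ 3 → u ≠ x := fun hu hx h => hx (h ▸ hu)
  have hbig : ∀ y, G.Adj v y → G.Adj w y → 5 ≤ G.degree y := fun y hvy hwy =>
    five_le_degree_of_two_cubic hG hL hn hvw (mem_cubicNeighbors.2 ⟨hvy.symm, hav.2⟩)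
      (mem_cubicNeighbors.2 ⟨hwy.symm, haw.2⟩)
  have hcy := charge_of_five_le_degree hG hL hn hs (hbig y hvy hwy)
  have hsum := sum_charge_le hG hL hn hs {a, y}
  rw [Finset.sum_pair hya.symm] at hsum
  obtain ⟨p, x, hvp, hvx, hap, hax, hpx, hNv⟩ := hL.exists_of_degree_eq_three hav.2 hav.1.symm
  obtain ⟨q, z, hwq, hwz, haq, haz, hqz, hNw⟩ := hL.exists_of_degree_eq_three haw.2 haw.1.symm
  -- Name the third neighbours of `v` and `w` by `x` and `z`.
  obtain ⟨x, hvx, hax, hyx, hNv⟩ : ∃ x, G.Adj v x ∧ G.Adj a x ∧ G.Adj y x ∧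
      ∀ t, G.Adj v t → t = a ∨ t = y ∨ t = x := by
    rcases (hNv y hvy).resolve_left hya with rfl | rfl
    · exact ⟨x, hvx, hax, hpx, hNv⟩
    · exact ⟨p, hvp, hap, hpx.symm, fun t ht => (hNv t ht).imp_right Or.symm⟩
  obtain ⟨z, hwz, haz, hyz, hNw⟩ : ∃ z, G.Adj w z ∧ G.Adj a z ∧ G.Adj y z ∧
      ∀ t, G.Adj w t → t = a ∨ t = y ∨ t = z := by
    rcases (hNw y hwy).resolve_left hya with rfl | rfl
    · exact ⟨z, hwz, haz, hqz, hNw⟩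
    · exact ⟨q, hwq, haq, hqz.symm, fun t ht => (hNw t ht).imp_right Or.symm⟩
  have hay : G.Adj a y := hL.adj_of_degree_eq_three hav.2 hav.1.symm hvy hya.symm
  have hxz : x ≠ z := by
    rintro rfl
    have hcx := charge_of_five_le_degree hG hL hn hs (hbig x hvx hwz)
    have hsum := sum_charge_le hG hL hn hs {a, y, x}
    rw [Finset.sum_insert (by simp [hya.symm, hax.ne]), Finset.sum_pair hyx.ne] at hsum
    omega
  have hvx' := hne hav.2 (hnot hav.2 hvx)
  have hvz' := hne hav.2 (hnot haw.2 hwz)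
  have hwx' := hne haw.2 (hnot hav.2 hvx)
  have hwz' := hne haw.2 (hnot haw.2 hwz)
  have hNa := eq_neighborFinset_of_card (G := G) (v := a) (s := {v, w, y, x, z})
    (by simp [hav.1, haw.1, hay, hax, haz]) (by
      rw [Finset.card_insert_of_notMem, Finset.card_insert_of_notMem,
        Finset.card_insert_of_notMem, Finset.card_pair hxz]
      · omega
      all_goals simp [hvw, hvy.ne, hvx.ne, hvz', hwy.ne, hwx', hwz', hyx.ne, hyz.ne])
  have hNy := eq_neighborFinset_of_card (G := G) (v := y) (s := {v, w, a, x, z})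
    (by simp [hvy.symm, hwy.symm, hay.symm, hyx, hyz]) (by
      rw [Finset.card_insert_of_notMem, Finset.card_insert_of_notMem,
        Finset.card_insert_of_notMem, Finset.card_pair hxz]
      · omega
      all_goals simp [hvw, hav.1.ne', hvx.ne, hvz', haw.1.ne', hwx', hwz', hax.ne, haz.ne])
  have := hG.card_le_of_cut {a, y, v, w} {x, z} Finset.card_le_two (x := a) (by simp)
    (by simp [hax.ne, haz.ne]) (by
      simp only [Finset.mem_insert, Finset.mem_singleton] at hNa hNy ⊢
      rintro t (rfl | rfl | rfl | rfl) s hts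
      · rcases hNa s hts with h | h | h | h | h <;> simp only [h, true_or, or_true]
      · rcases hNy s hts with h | h | h | h | h <;> simp only [h, true_or, or_true]
      · rcases hNv s hts with h | h | h <;> simp only [h, true_or, or_true]
      · rcases hNw s hts with h | h | h <;> simp only [h, true_or, or_true])
  have h1 := Finset.card_union_le {a, y, v, w} {x, z}
  have h2 := Finset.card_le_four (a := a) (b := y) (c := v) (d := w)
  have h3 := Finset.card_le_two (a := x) (b := z)
  omega
/-- If two cubic neighbours of `a` share no further neighbour, then `a` has degree at least six,
and its charge is too large. -/
lemma not_disjoint_cubicNeighbors (hG : IsKConnected 3 G) (hL : LocallyNonforesty G)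
    (hn : 8 ≤ Fintype.card V) (hs : ∑ v, charge G v ≤ 6) {a v w : V} (hvw : v ≠ w)
    (hv : v ∈ cubicNeighbors G a) (hw : w ∈ cubicNeighbors G a)
    (hshare : ∀ y, y ≠ a → G.Adj v y → ¬G.Adj w y) : False := by
  have hav := mem_cubicNeighbors.1 hv
  have haw := mem_cubicNeighbors.1 hw
  have ha5 := five_le_degree_of_two_cubic hG hL hn hvw hv hw
  have hca := charge_of_five_le_degree hG hL hn hs ha5
  have hnot : ∀ {u x}, G.degree u = 3 → G.Adj u x → G.degree x ≠ 3 := fun hu hux hx =>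
    not_adj_of_degree_eq_three hG hL hn hu hx hux
  have hne : ∀ {u x : V}, G.degree u = 3 → G.degree x ≠ 3 → u ≠ x := fun hu hx h => hx (h ▸ hu)
  obtain ⟨p, x, hvp, hvx, hap, hax, hpx, hNv⟩ := hL.exists_of_degree_eq_three hav.2 hav.1.symm
  obtain ⟨q, z, hwq, hwz, haq, haz, hqz, hNw⟩ := hL.exists_of_degree_eq_three haw.2 haw.1.symm
  have h6 : ({v, w, p, x, q, z} : Finset V).card = 6 := by
    have := hne hav.2 (hnot haw.2 hwq)
    have := hne hav.2 (hnot haw.2 hwz)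
    have := hne haw.2 (hnot hav.2 hvp)
    have := hne haw.2 (hnot hav.2 hvx)
    have : p ≠ q := fun h => hshare p hap.ne' hvp (h ▸ hwq)
    have : p ≠ z := fun h => hshare p hap.ne' hvp (h ▸ hwz)
    have : x ≠ q := fun h => hshare x hax.ne' hvx (h ▸ hwq)
    have : x ≠ z := fun h => hshare x hax.ne' hvx (h ▸ hwz)
    have := hvp.ne
    have := hvx.ne
    have := hwq.ne
    have := hwz.ne
    have := hpx.ne
    have := hqz.ne
    rw [Finset.card_insert_of_notMem, Finset.card_insert_of_notMem,
      Finset.card_insert_of_notMem, Finset.card_insert_of_notMem, Finset.card_pair]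
    all_goals simp [*]
  have hNa := eq_neighborFinset_of_card (G := G) (v := a) (s := {v, w, p, x, q, z})
    (by simp [hav.1, haw.1, hap, hax, haq, haz]) (by omega)
  have hsub : cubicNeighbors G a ⊆ {v, w} := by
    intro t ht
    have ht' := mem_cubicNeighbors.1 ht
    have := hNa t ht'.1
    simp only [Finset.mem_insert, Finset.mem_singleton] at this ⊢
    rcases this with h | h | rfl | rfl | rfl | rfl
    · exact .inl h
    · exact .inr h
    exacts [absurd ht'.2 (hnot hav.2 hvp), absurd ht'.2 (hnot hav.2 hvx),
      absurd ht'.2 (hnot haw.2 hwq), absurd ht'.2 (hnot haw.2 hwz)]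
  have h2 := (Finset.card_le_card hsub).trans Finset.card_le_two
  have h6' : 6 ≤ G.degree a := by
    rw [← h6]
    refine Finset.card_le_card fun t ht => (G.mem_neighborFinset a t).2 ?_
    simp only [Finset.mem_insert, Finset.mem_singleton] at ht
    rcases ht with rfl | rfl | rfl | rfl | rfl | rfl
    exacts [hav.1, haw.1, hap, hax, haq, haz]
  rw [charge_of_degree_ne_three (by omega)] at hca
  omega

lemma card_cubicNeighbors_le_one_of_charge (hG : IsKConnected 3 G) (hL : LocallyNonforesty G)
    (hn : 8 ≤ Fintype.card V) (hs : ∑ v, charge G v ≤ 6) (a : V) :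
    (cubicNeighbors G a).card ≤ 1 := by
  by_contra hcon
  obtain ⟨v, hv, w, hw, hvw⟩ := Finset.one_lt_card.1 (not_le.1 hcon)
  exact not_disjoint_cubicNeighbors hG hL hn hs hvw hv hw fun y hya hvy hwy =>
    not_common_of_cubicNeighbors hG hL hn hs hvw hv hw hya hvy hwy

end SmallCharge

/-! ### Vertices without cubic vertices nearby -/

section Deficient

variable {V : Type*} [Fintype V] [DecidableEq V] {G : SimpleGraph V} [DecidableRel G.Adj]

/-- The vertices that neither have degree three nor a neighbour of degree three. -/
def freeVertices (G : SimpleGraph V) [DecidableRel G.Adj] : Finset V :=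
  Finset.univ.filter fun v => G.degree v ≠ 3 ∧ cubicNeighbors G v = ∅

lemma degree_eq_five_of_charge (hG : IsKConnected 3 G) (hL : LocallyNonforesty G)
    (hn : 8 ≤ Fintype.card V) (hs : ∑ v, charge G v ≤ 6) {a : V} (ha : 5 ≤ G.degree a) :
    G.degree a = 5 ∧ 4 ≤ charge G a := by
  have h1 := charge_of_five_le_degree hG hL hn hs ha
  have h2 := card_cubicNeighbors_le_one_of_charge hG hL hn hs a
  rw [charge_of_degree_ne_three (by omega)] at h1 ⊢
  omega

lemma eq_of_five_le_degree (hG : IsKConnected 3 G) (hL : LocallyNonforesty G)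
    (hn : 8 ≤ Fintype.card V) (hs : ∑ v, charge G v ≤ 6) {a b : V} (ha : 5 ≤ G.degree a)
    (hb : 5 ≤ G.degree b) : a = b := by
  by_contra hab
  have h1 := degree_eq_five_of_charge hG hL hn hs ha
  have h2 := degree_eq_five_of_charge hG hL hn hs hb
  have := sum_charge_le hG hL hn hs {a, b}
  rw [Finset.sum_pair hab] at this
  omega

lemma one_le_charge_of_mem_freeVertices (hL : LocallyNonforesty G) {v : V}
    (hv : v ∈ freeVertices G) : 1 ≤ charge G v := by
  simp only [freeVertices, Finset.mem_filter, Finset.mem_univ, true_and] at hv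
  have := hL.three_le_degree v
  rw [charge_of_degree_ne_three hv.1, hv.2, Finset.card_empty]
  omega

lemma charge_of_notMem_freeVertices (hG : IsKConnected 3 G) (hL : LocallyNonforesty G)
    (hn : 8 ≤ Fintype.card V) (hs : ∑ v, charge G v ≤ 6) {v : V} (hv : v ∉ freeVertices G) :
    (G.degree v ≤ 4 ∧ charge G v = 0) ∨ (G.degree v = 5 ∧ charge G v = 4) := by
  simp only [freeVertices, Finset.mem_filter, Finset.mem_univ, true_and, not_and] at hv
  have h3 := hL.three_le_degree v
  by_cases h : G.degree v = 3
  · exact .inl ⟨by omega, charge_of_degree_eq_three hG hL hn h⟩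
  · have h1 := card_cubicNeighbors_le_one_of_charge hG hL hn hs v
    have h2 := Finset.card_pos.2 (Finset.nonempty_iff_ne_empty.2 (hv h))
    have h5 := degree_eq_five_of_charge hG hL hn hs (a := v)
    rw [charge_of_degree_ne_three h] at h5 ⊢
    omega

/-- A vertex `x` of degree four on a cycle in the neighbourhood of a free vertex `u` is free.
Otherwise `x` lies in a `K₄` with a vertex `v` of degree three, the cycle runs through the other two
vertices `b` and `c` of that `K₄`, and `u` together with `b` separates the graph. -/
lemma mem_freeVertices_or_five_le_degree (hG : IsKConnected 3 G) (hL : LocallyNonforesty G)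
    (hn : 8 ≤ Fintype.card V) (hs : ∑ v, charge G v ≤ 6) {u : V} (hu : u ∈ freeVertices G)
    {C : Finset V} (hCu : ∀ x ∈ C, G.Adj u x)
    (hC : ∀ x ∈ C, ∃ a ∈ C, ∃ b ∈ C, a ≠ b ∧ G.Adj x a ∧ G.Adj x b) {x : V} (hx : x ∈ C) :
    x ∈ freeVertices G ∨ 5 ≤ G.degree x := by
  by_contra! hcon
  obtain ⟨hxf, hx5⟩ := hcon
  simp only [freeVertices, Finset.mem_filter, Finset.mem_univ, true_and, not_and] at hu hxf
  have hu3 : ∀ v, G.degree v = 3 → ¬G.Adj u v := by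
    intro v hv huv
    have : v ∈ cubicNeighbors G u := mem_cubicNeighbors.2 ⟨huv, hv⟩
    simp [hu.2] at this
  have hx3 : G.degree x ≠ 3 := fun h => hu3 x h (hCu x hx)
  have hx4 : G.degree x = 4 := by have := hL.three_le_degree x; omega
  obtain ⟨v, hv⟩ := Finset.nonempty_iff_ne_empty.2 (hxf hx3)
  obtain ⟨hxv, hv3⟩ := mem_cubicNeighbors.1 hv
  obtain ⟨b, c, hvb, hvc, hxb, hxc, hbc, hNv⟩ := hL.exists_of_degree_eq_three hv3 hxv.symm
  have huv := hu3 v hv3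
  have hub : u ≠ b := fun h => huv (h ▸ hvb.symm)
  have huc : u ≠ c := fun h => huv (h ▸ hvc.symm)
  have huv' : u ≠ v := fun h => hu.1 (h ▸ hv3)
  have hux := hCu x hx
  have hNx := eq_neighborFinset_of_card (G := G) (v := x) (s := {u, v, b, c})
    (by simp [hux.symm, hxv, hxb, hxc]) (by
      rw [Finset.card_insert_of_notMem, Finset.card_insert_of_notMem, Finset.card_pair hbc.ne]
      · omega
      all_goals simp [hvb.ne, hvc.ne, huv', hub, huc])
  have hbcC : b ∈ C ∧ c ∈ C := by
    obtain ⟨p, hp, q, hq, hpq, hxp, hxq⟩ := hC x hx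
    have hp' := hNx p hxp
    have hq' := hNx q hxq
    simp only [Finset.mem_insert, Finset.mem_singleton] at hp' hq'
    have hpu := (hCu p hp).ne'
    have hqu := (hCu q hq).ne'
    have hpv : p ≠ v := fun h => huv (h ▸ hCu p hp)
    have hqv : q ≠ v := fun h => huv (h ▸ hCu q hq)
    rcases (hp'.resolve_left hpu).resolve_left hpv with rfl | rfl <;>
      rcases (hq'.resolve_left hqu).resolve_left hqv with rfl | rfl
    exacts [absurd rfl hpq, ⟨hp, hq⟩, ⟨hq, hp⟩, absurd rfl hpq]
  have hub' := hCu b hbcC.1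
  have huc' := hCu c hbcC.2
  -- At most one of `b` and `c` has degree five; the other one has no neighbour elsewhere.
  obtain ⟨b, c, hvb, hvc, hxb, hxc, hbc, hNv, hub, huc, hub', huc', hNx, hc4⟩ :
      ∃ b c, G.Adj v b ∧ G.Adj v c ∧ G.Adj x b ∧ G.Adj x c ∧ G.Adj b c ∧
        (∀ y, G.Adj v y → y = x ∨ y = b ∨ y = c) ∧ u ≠ b ∧ u ≠ c ∧ G.Adj u b ∧ G.Adj u c ∧
        (∀ y, G.Adj x y → y ∈ ({u, v, b, c} : Finset V)) ∧ G.degree c ≤ 4 := by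
    by_cases hc : G.degree c ≤ 4
    · exact ⟨b, c, hvb, hvc, hxb, hxc, hbc, hNv, hub, huc, hub', huc', hNx, hc⟩
    · refine ⟨c, b, hvc, hvb, hxc, hxb, hbc.symm, fun y hy => (hNv y hy).imp_right Or.symm, huc,
        hub, huc', hub', fun y hy => ?_, ?_⟩
      · have := hNx y hy
        simp only [Finset.mem_insert, Finset.mem_singleton] at this ⊢
        tauto
      · by_contra hb
        exact hbc.ne (eq_of_five_le_degree hG hL hn hs (by omega) (by omega))
  have hNc := eq_neighborFinset_of_card (G := G) (v := c) (s := {u, v, x, b})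
    (by simp [huc'.symm, hvc.symm, hxc.symm, hbc.symm]) (by
      rw [Finset.card_insert_of_notMem, Finset.card_insert_of_notMem, Finset.card_pair hxb.ne]
      · omega
      all_goals simp [hvb.ne, hxv.ne', huv', hub, hux.ne])
  have := hG.card_le_of_cut {v, x, c} {b, u} Finset.card_le_two (x := v) (by simp)
    (by simp [hvb.ne, huv'.symm]) (by
      simp only [Finset.mem_insert, Finset.mem_singleton] at hNx hNc ⊢
      rintro t (rfl | rfl | rfl) s hts
      · rcases hNv s hts with h | h | h <;> simp only [h, true_or, or_true]
      · rcases hNx s hts with h | h | h | h <;> simp only [h, true_or, or_true]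
      · rcases hNc s hts with h | h | h | h <;> simp only [h, true_or, or_true])
  have h1 := Finset.card_union_le {v, x, c} {b, u}
  have h2 := Finset.card_le_three (a := v) (b := x) (c := c)
  have h3 := Finset.card_le_two (a := b) (b := u)
  omega

lemma subset_freeVertices_of_core (hG : IsKConnected 3 G) (hL : LocallyNonforesty G)
    (hn : 8 ≤ Fintype.card V) (hs : ∑ v, charge G v ≤ 6) {u : V} (hu : u ∈ freeVertices G)
    {C : Finset V} (hCne : C.Nonempty) (hCu : ∀ x ∈ C, G.Adj u x)
    (hC : ∀ x ∈ C, ∃ a ∈ C, ∃ b ∈ C, a ≠ b ∧ G.Adj x a ∧ G.Adj x b) :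
    C ⊆ freeVertices G := by
  intro x hx
  have key := fun {y} => mem_freeVertices_or_five_le_degree hG hL hn hs hu hCu hC (x := y)
  rcases key hx with h | hx5
  · exact h
  exfalso
  -- The charge of `x` is at least four, and three free vertices have charge at least one.
  have huC : u ∉ C.erase x := fun h => (hCu u (Finset.mem_of_mem_erase h)).ne rfl
  have hxu : x ∉ insert u (C.erase x) := by simp [(hCu x hx).ne']
  have hsum := sum_charge_le hG hL hn hs (insert x (insert u (C.erase x)))
  rw [Finset.sum_insert hxu] at hsum
  have hone : ∀ y ∈ insert u (C.erase x), 1 ≤ charge G y := by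
    intro y hy
    refine one_le_charge_of_mem_freeVertices hL ?_
    rcases Finset.mem_insert.1 hy with rfl | hy
    · exact hu
    · refine (key (Finset.mem_of_mem_erase hy)).resolve_right fun hy5 => ?_
      exact Finset.ne_of_mem_erase hy (eq_of_five_le_degree hG hL hn hs hy5 hx5)
  have h1 : ((insert u (C.erase x)).card : ℤ) ≤ ∑ y ∈ insert u (C.erase x), charge G y := by
    simpa using Finset.card_nsmul_le_sum _ _ _ hone
  rw [Finset.card_insert_of_notMem huC, Finset.card_erase_of_mem hx] at h1
  have h2 := three_le_card_core hCne hC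
  have h3 := (degree_eq_five_of_charge hG hL hn hs hx5).2
  omega

lemma four_le_card_freeVertices (hG : IsKConnected 3 G) (hL : LocallyNonforesty G)
    (hn : 8 ≤ Fintype.card V) (hs : ∑ v, charge G v ≤ 6) {u : V} (hu : u ∈ freeVertices G) :
    4 ≤ (freeVertices G).card := by
  obtain ⟨C, hCne, hCu, hC⟩ := hL.exists_core u
  have h1 := subset_freeVertices_of_core hG hL hn hs hu hCne hCu hC
  have huC : u ∉ C := fun h => (hCu u h).ne rfl
  have h2 := Finset.card_le_card (Finset.insert_subset hu h1)
  rw [Finset.card_insert_of_notMem huC] at h2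
  have := three_le_card_core hCne hC
  omega

lemma degree_le_four_of_freeVertices_nonempty (hG : IsKConnected 3 G) (hL : LocallyNonforesty G)
    (hn : 8 ≤ Fintype.card V) (hs : ∑ v, charge G v ≤ 6) {u : V} (hu : u ∈ freeVertices G)
    (a : V) : G.degree a ≤ 4 := by
  by_contra ha
  have ha' := (degree_eq_five_of_charge hG hL hn hs (a := a) (by omega)).2
  have hsum := sum_charge_le hG hL hn hs (insert a ((freeVertices G).erase a))
  rw [Finset.sum_insert (by simp)] at hsum
  have h1 : (((freeVertices G).erase a).card : ℤ) ≤ ∑ y ∈ (freeVertices G).erase a, charge G y := by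
    simpa using Finset.card_nsmul_le_sum ((freeVertices G).erase a) (charge G) 1
      fun y hy => one_le_charge_of_mem_freeVertices hL (Finset.mem_of_mem_erase hy)
  have h2 := four_le_card_freeVertices hG hL hn hs hu
  have h3 := Finset.pred_card_le_card_erase (s := freeVertices G) (a := a)
  omega

lemma sum_charge_eq_card_freeVertices (hG : IsKConnected 3 G) (hL : LocallyNonforesty G)
    (hn : 8 ≤ Fintype.card V) (hs : ∑ v, charge G v ≤ 6) {u : V} (hu : u ∈ freeVertices G) :
    ∑ v, charge G v = (freeVertices G).card := by
  have hdeg := degree_le_four_of_freeVertices_nonempty hG hL hn hs hu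
  rw [← Finset.sum_subset (Finset.subset_univ (freeVertices G)), Finset.sum_congr rfl (g := 1)]
  · simp
  · intro v hv
    simp only [freeVertices, Finset.mem_filter, Finset.mem_univ, true_and] at hv
    have := hL.three_le_degree v
    have := hdeg v
    rw [charge_of_degree_ne_three hv.1, hv.2, Finset.card_empty, Pi.one_apply]
    omega
  · intro v _ hv
    have := hdeg v
    have := charge_of_notMem_freeVertices hG hL hn hs hv
    omega

/-- Five or six free vertices are impossible: at least three of them have a neighbour that is not
free; for such a vertex `u`, its free neighbours form a triangle `C`, and the degrees leave no room
for the remaining one or two free vertices, which have three free neighbours each. -/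
lemma card_freeVertices_le_four (hG : IsKConnected 3 G) (hL : LocallyNonforesty G)
    (hn : 8 ≤ Fintype.card V) (hs : ∑ v, charge G v ≤ 6) {u : V} (hu : u ∈ freeVertices G) :
    (freeVertices G).card ≤ 4 := by
  by_contra hcon
  have hdeg := degree_le_four_of_freeVertices_nonempty hG hL hn hs hu
  have hcard := sum_charge_eq_card_freeVertices hG hL hn hs hu
  set D := freeVertices G with hD
  have hcore : ∀ u ∈ D, ∃ C ⊆ D, 3 ≤ C.card ∧ (∀ x ∈ C, G.Adj u x) ∧
      ∀ x ∈ C, ∃ a ∈ C, ∃ b ∈ C, a ≠ b ∧ G.Adj x a ∧ G.Adj x b := by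
    intro u hu
    obtain ⟨C, hCne, hCu, hC⟩ := hL.exists_core u
    exact ⟨C, subset_freeVertices_of_core hG hL hn hs hu hCne hCu hC, three_le_card_core hCne hC,
      hCu, hC⟩
  let Y := D.filter fun v => ∃ y, G.Adj v y ∧ y ∉ D
  have hY : 2 < Y.card := by
    by_contra hY
    obtain ⟨x, hx, hxY⟩ := Finset.exists_mem_notMem_of_card_lt_card (s := Y) (t := D) (by omega)
    have := hG.card_le_of_cut (D \ Y) Y (by omega) (x := x) (by simp [hx, hxY]) hxY (by
      intro t ht s hts
      simp only [Finset.mem_sdiff] at ht ⊢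
      have hsD : s ∈ D := by
        by_contra hsD
        exact ht.2 (Finset.mem_filter.2 ⟨ht.1, s, hts, hsD⟩)
      tauto)
    rw [Finset.sdiff_union_of_subset (Finset.filter_subset _ _)] at this
    omega
  obtain ⟨u, huY⟩ := Finset.card_pos.1 (by omega : 0 < Y.card)
  obtain ⟨hu, y, huy, hyD⟩ := Finset.mem_filter.1 huY
  obtain ⟨C, hCD, hC3, hCu, hC⟩ := hcore u hu
  have hyC : y ∉ C := fun h => hyD (hCD h)
  have huC : u ∉ C := fun h => (hCu u h).ne rfl
  have hNu := eq_neighborFinset_of_card (G := G) (v := u) (s := insert y C)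
    (by simpa [huy] using hCu)
    (by rw [Finset.card_insert_of_notMem hyC]; have := hdeg u; omega)
  have hC3' : C.card = 3 := by
    have : (insert y C).card ≤ G.degree u := Finset.card_le_card fun t ht => by
      rw [SimpleGraph.mem_neighborFinset]
      rcases Finset.mem_insert.1 ht with rfl | ht
      exacts [huy, hCu t ht]
    rw [Finset.card_insert_of_notMem hyC] at this
    have := hdeg u
    omega
  have hclique : ∀ a ∈ C, ∀ b ∈ C, a ≠ b → G.Adj a b := by
    intro a ha b hb hab
    obtain ⟨p, hp, q, hq, hpq, hap, haq⟩ := hC a ha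
    have hsub : ({p, q} : Finset V) = C.erase a := by
      refine Finset.eq_of_subset_of_card_le ?_ ?_
      · simp [Finset.insert_subset_iff, hp, hq, hap.ne', haq.ne']
      · rw [Finset.card_erase_of_mem ha, Finset.card_pair hpq]; omega
    have : b ∈ ({p, q} : Finset V) := by rw [hsub]; simp [hb, hab.symm]
    simp only [Finset.mem_insert, Finset.mem_singleton] at this
    rcases this with rfl | rfl <;> assumption
  have hQD : insert u C ⊆ D := Finset.insert_subset hu hCD
  set E := D \ insert u C with hE
  have hEcard : E.card + 4 = D.card := by
    have := Finset.card_sdiff_add_card_eq_card hQD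
    rw [Finset.card_insert_of_notMem huC, ← hE] at this
    omega
  have hE' : ∀ x ∈ E, x ∈ D ∧ x ≠ u ∧ x ∉ C := by
    intro x hx
    simpa [hE, not_or] using hx
  -- A vertex of the triangle has room for one neighbour besides `u` and the triangle.
  have hroom : ∀ a ∈ C, ∀ s, s ∉ insert u C → G.Adj a s →
      ∀ t, G.Adj a t → t ∈ insert s (insert u C) := by
    intro a ha s hs has t hat
    have hsa : s ∉ insert u (C.erase a) := fun h =>
      hs (Finset.insert_subset_insert u (Finset.erase_subset a C) h)
    have hua : u ∉ C.erase a := fun h => huC (Finset.mem_of_mem_erase h)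
    have := eq_neighborFinset_of_card (G := G) (v := a) (s := insert s (insert u (C.erase a)))
      (by
        simp only [Finset.mem_insert, Finset.mem_erase]
        rintro r (rfl | rfl | ⟨hra, hr⟩)
        exacts [has, (hCu a ha).symm, hclique a ha r hr hra.symm])
      (by
        rw [Finset.card_insert_of_notMem hsa, Finset.card_insert_of_notMem hua,
          Finset.card_erase_of_mem ha]
        have := hdeg a
        omega) t hat
    simp only [Finset.mem_insert, Finset.mem_erase] at this ⊢
    tauto
  have hmany : ∀ x ∈ E, 4 ≤ (C.filter (G.Adj x)).card + E.card := by
    intro x hx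
    obtain ⟨hxD, hxu, hxC⟩ := hE' x hx
    obtain ⟨Cx, hCxD, hCx3, hCxx, -⟩ := hcore x hxD
    have hsub : Cx ⊆ C.filter (G.Adj x) ∪ E.erase x := by
      intro t ht
      have hxt := hCxx t ht
      have htu : t ≠ u := by
        rintro rfl
        have := hNu x hxt.symm
        simp only [Finset.mem_insert] at this
        rcases this with rfl | h
        exacts [hyD hxD, hxC h]
      by_cases htC : t ∈ C
      · simp [htC, hxt]
      · simp [hE, htC, htu, hCxD ht, hxt.ne']
    have h1 := (Finset.card_le_card hsub).trans (Finset.card_union_le _ _)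
    rw [Finset.card_erase_of_mem hx] at h1
    have := Finset.card_pos.2 ⟨x, hx⟩
    omega
  have hE12 : E.card = 1 ∨ E.card = 2 := by omega
  rcases hE12 with h1 | h2
  · obtain ⟨x, hxE⟩ := Finset.card_eq_one.1 h1
    have hx : x ∈ E := by simp [hxE]
    have hfull : C.filter (G.Adj x) = C := Finset.eq_of_subset_of_card_le
      (Finset.filter_subset _ _) (by have := hmany x hx; omega)
    have hYsub : Y ⊆ {u, x} := by
      intro a ha
      obtain ⟨haD, t, hat, htD⟩ := Finset.mem_filter.1 ha
      by_contra hne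
      simp only [Finset.mem_insert, Finset.mem_singleton, not_or] at hne
      have haC : a ∈ C := by
        by_contra haC
        have : a ∈ E := by simp [hE, haD, hne.1, haC]
        rw [hxE, Finset.mem_singleton] at this
        exact hne.2 this
      have hxa : G.Adj x a := by
        have : a ∈ C.filter (G.Adj x) := hfull.symm ▸ haC
        exact (Finset.mem_filter.1 this).2
      have := hroom a haC x (Finset.mem_sdiff.1 hx).2 hxa.symm t hat
      rcases Finset.mem_insert.1 this with rfl | h
      exacts [htD (hE' _ hx).1, htD (hQD h)]
    have := (Finset.card_le_card hYsub).trans Finset.card_le_two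
    omega
  · obtain ⟨x, z, hxz, hxE⟩ := Finset.card_eq_two.1 h2
    have hx : x ∈ E := by simp [hxE]
    have hz : z ∈ E := by simp [hxE]
    have hcommon : (C.filter (G.Adj x) ∩ C.filter (G.Adj z)).Nonempty := by
      refine Finset.inter_nonempty_of_card_lt_card_add_card (Finset.filter_subset _ C)
        (Finset.filter_subset _ C) ?_
      have := hmany x hx
      have := hmany z hz
      omega
    obtain ⟨a, ha⟩ := hcommon
    simp only [Finset.mem_inter, Finset.mem_filter] at ha
    have := hroom a ha.1.1 x (Finset.mem_sdiff.1 hx).2 ha.1.2.symm z ha.2.2.symm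
    rcases Finset.mem_insert.1 this with h | h
    exacts [hxz h.symm, (Finset.mem_sdiff.1 hz).2 h]

/-- The total charge, if at most six, is `0` or `4`. -/
lemma sum_charge_eq_zero_or_four (hG : IsKConnected 3 G) (hL : LocallyNonforesty G)
    (hn : 8 ≤ Fintype.card V) (hs : ∑ v, charge G v ≤ 6) :
    ∑ v, charge G v = 0 ∨ ∑ v, charge G v = 4 := by
  rcases (freeVertices G).eq_empty_or_nonempty with h | ⟨u, hu⟩
  · have hch : ∀ v, (G.degree v ≤ 4 ∧ charge G v = 0) ∨ (G.degree v = 5 ∧ charge G v = 4) :=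
      fun v => charge_of_notMem_freeVertices hG hL hn hs (by simp [h])
    by_cases h5 : ∃ a, G.degree a = 5
    · obtain ⟨a, ha⟩ := h5
      right
      rw [Finset.sum_eq_single a]
      · have := hch a; omega
      · intro b _ hba
        rcases hch b with hb | hb
        · exact hb.2
        · exact absurd (eq_of_five_le_degree hG hL hn hs hb.1.ge ha.ge) hba
      · simp
    · left
      refine Finset.sum_eq_zero fun v _ => ?_
      rcases hch v with hv | hv
      · exact hv.2
      · exact absurd ⟨v, hv.1⟩ h5
  · right
    have h1 := sum_charge_eq_card_freeVertices hG hL hn hs hu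
    have h2 := four_le_card_freeVertices hG hL hn hs hu
    have h3 := card_freeVertices_le_four hG hL hn hs hu
    omega

end Deficient

lemma minSizeFormula_le_ncard {V : Type*} [Fintype V] {G : SimpleGraph V} (hG : IsKConnected 3 G)
    (hL : LocallyNonforesty G) (hn : 8 ≤ Fintype.card V) :
    minSizeFormula (Fintype.card V) ≤ G.edgeSet.ncard := by
  classical
  have h1 := sum_charge (G := G)
  have h2 : 0 ≤ ∑ v, charge G v := Finset.sum_nonneg fun v _ => charge_nonneg hG hL hn v
  have h3 := sum_charge_eq_zero_or_four hG hL hn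
  rw [← SimpleGraph.coe_edgeFinset, Set.ncard_coe_finset]
  unfold minSizeFormula
  split_ifs <;> omega

theorem theorem1 {V : Type*} [Fintype V] (n : ℕ) (hn : 8 ≤ n) (hV : Fintype.card V = n) :
    IsLeast {m : ℕ | ∃ G : SimpleGraph V,
        IsKConnected 3 G ∧ LocallyNonforesty G ∧ G.edgeSet.ncard = m} (minSizeFormula n) ∧
      ((minSizeFormula n : ℝ) ≤ 2 * (n : ℝ) ∧ 2 * (n : ℝ) < 7 * ((n : ℝ) - 1) / 3) ∧
      ∃ G : SimpleGraph V, IsKConnected 3 G ∧ LocallyNonforesty G ∧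
        (G.edgeSet.ncard : ℝ) < 7 * ((n : ℝ) - 1) / 3 := by
  subst hV
  obtain ⟨G, hG, hL, hm⟩ := exists_size_minSizeFormula hn
  have h1 : (minSizeFormula (Fintype.card V) : ℝ) ≤ 2 * (Fintype.card V : ℝ) := by
    have : minSizeFormula (Fintype.card V) ≤ 2 * Fintype.card V := by
      unfold minSizeFormula
      split_ifs <;> omega
    exact_mod_cast this
  have h2 : 2 * (Fintype.card V : ℝ) < 7 * ((Fintype.card V : ℝ) - 1) / 3 := by
    have : (8 : ℝ) ≤ Fintype.card V := by exact_mod_cast hn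
    linarith
  refine ⟨⟨⟨G, hG, hL, hm⟩, ?_⟩, ⟨h1, h2⟩, G, hG, hL, by rw [hm]; linarith⟩
  rintro m ⟨G', hG', hL', rfl⟩
  exact minSizeFormula_le_ncard hG' hL' hn
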